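/- Let $\mathbb X$ be a finite-dimensional real inner product space with norm $\|\cdot\|$; matrix spaces carry the trace inner product and the Frobenius norm. Consider $$\min_{x\in\mathbb X}\ \Theta(x):=\vartheta(|F(x)|)+\nu\,\psi(T(x))+\lambda h(x),\qquad \nu\ge 0,\ \lambda>0,$$ where $|\cdot|$ is the entrywise absolute value and: * $h:\mathbb X\to(-\infty,\infty]$ is proper, lsc, convex, bounded below, and strictly continuous (locally Lipschitz) relative to its domain $\operatorname{dom}h$; * $F:\mathcal O\to\mathbb R^{m\times n}$ and $T:\mathcal O\to\mathbb R^{p\times q}$ are continuously differentiable on an open set $\mathcal O\supset\operatorname{dom}h$; * $\psi:\mathbb R^{p\times q}\to\mathbb R$ is convex and bounded below; * $\vartheta(z)=\sum_{i,j}\theta_0(z_{ij})$, where $\theta_0$ is concave and differentiable on an open interval $I\supset[0,\infty)$ with locally Lipschitz derivative, $\theta_0'\ge0$ on $[0,\infty)$ and $\theta_0(0)=0$; $\nabla\vartheta(z)$ is the matrix with entries $\theta_0'(z_{ij})$. Write $\ell_F(x;z)=F(z)+F'(z)(x-z)$ and $\ell_T(x;z)=T(z)+T'(z)(x-z)$.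 Let $\partial$ be the basic (limiting) subdifferential, and let $\nabla F(x)$, $\nabla T(x)$ be the adjoints of $F'(x)$, $T'(x)$. A point $x\in\operatorname{dom}h$ is *stationary* if $$0\in\nabla F(x)\big[\nabla\vartheta(|F(x)|)\circ\partial|F(x)|\big]+\nu\nabla T(x)\,\partial\psi(T(x))+\lambda\,\partial h(x),$$ where $y\circ\partial|z|$ is the set of matrices $v$ with $v_{ij}\in y_{ij}\,\partial|\cdot|(z_{ij})$. **Algorithm (inexact proximal MM).** Fix $\varrho>1$, $0<\underline\gamma<\overline\gamma$, $\overline\mu>0$, $\mu_k\in(0,\overline\mu]$ and $x^0\in\mathcal O$. At iteration $k$ choose $\gamma_{k,0}\in[\underline\gamma,\overline\gamma]$. For $j=0,1,2,\dots$ choose a self-adjoint $\mathcal Q_{k,j}$ with $\gamma_{k,j}\mathcal I\preceq\mathcal Q_{k,j}\preceq\varrho\gamma_{k,j}\mathcal I$, put $$\Theta_{k,j}(x)=\langle\nabla\vartheta(|F(x^k)|),|\ell_F(x;x^k)|\rangle+\nu\psi(\ell_T(x;x^k))+\lambda h(x)+\tfrac12\langle x-x^k,\mathcal Q_{k,j}(x-x^k)\rangle+C^k,$$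 $C^k=\vartheta(|F(x^k)|)-\langle\nabla\vartheta(|F(x^k)|),|F(x^k)|\rangle$, let $\overline x^{k,j}$ be the minimizer of $\Theta_{k,j}$, and find $x^{k,j}$ with $$\Theta_{k,j}(x^{k,j})<\Theta(x^k),\qquad \Theta_{k,j}(x^{k,j})-\Theta_{k,j}(\overline x^{k,j})\le\tfrac{\mu_k}{2}\big(\Theta(x^k)-\Theta_{k,j}(x^{k,j})\big).$$ If $\Theta(x^{k,j})\le\Theta_{k,j}(x^{k,j})$, set $j_k=j$, $x^{k+1}=x^{k,j_k}$ and pass to iteration $k+1$; otherwise set $\gamma_{k,j+1}=\varrho\gamma_{k,j}$ and continue with $j+1$. **KL functions.** For $\eta\in(0,\infty]$ let $\Upsilon_\eta$ be the set of continuous concave $\varphi:[0,\eta)\to[0,\infty)$ that are $C^1$ on $(0,\eta)$ with $\varphi(0)=0$ and $\varphi'>0$ on $(0,\eta)$. A proper lsc function $f$ is a *KL function of exponent* $\theta\in[0,1)$ if for each $\overline w$ with $\partial f(\overline w)\ne\emptyset$ there are $\eta\in(0,\infty]$, $c>0$ and a neighborhood $V$ of $\overline w$ such that $\varphi(s)=cs^{1-\theta}$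 belongs to $\Upsilon_\eta$ and $\varphi'(f(w)-f(\overline w))\operatorname{dist}(0,\partial f(w))\ge1$ for all $w\in V$ with $f(\overline w)<f(w)<f(\overline w)+\eta$. **Statement.** Let $\{x^k\}_{k\in\mathbb N}$ be an infinite sequence generated by the algorithm. Suppose that it is bounded and that $F$ and $T$ are twice continuously differentiable on $\mathcal O$. Then there is $\widetilde\gamma>0$ with $\gamma_{k,j_k}\le\widetilde\gamma$ for all $k$. Moreover, for every such $\widetilde\gamma$ and every $\theta\in(0,1)$, if with $\widehat\gamma=2\varrho\widetilde\gamma$ the potential function $$\Xi(x,z,t)=\vartheta(|\ell_F(x;z)|)+\nu\psi(\ell_T(x;z))+\lambda h(x)+\tfrac{\widehat\gamma}{2}\|x-z\|^2+t^2,\qquad (x,z,t)\in\mathbb X\times\mathcal O\times\mathbb R,$$ is a KL function of exponent $\theta$, then $\{x^k\}$ converges to a stationary point $x^*$, and 1. if $\theta\in(0,\frac12]$, there exist $C>0$ and $r\in(0,1)$ such that $\Theta(x^k)-\Theta(x^*)\le C r^k$ for all $k$ large enough; 2. if $\theta\in(\frac12,1)$, there exists $C>0$ such that $\Theta(x^k)-\Theta(x^*)\le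 C k^{-\frac1{2\theta-1}}$ for all $k$ large enough. -/

import Mathlib

open Filter Topology Set
open scoped Pointwise

noncomputable section

/-! ### Subdifferentials and the Kurdyka-Lojasiewicz property -/

section Subdifferential

variable {E : Type*} [NormedAddCommGroup E] [InnerProductSpace ℝ E]

/-- The effective domain of an extended real-valued function `f : E → (-∞, ∞]`. -/
def effDom (f : E → EReal) : Set E := {x | f x < ⊤}

/-- The regular (Fréchet) subdifferential: `x ∈ dom f` and
`f x' ≥ f x + ⟪v, x' - x⟫ + o(‖x' - x‖)` as `x' → x`, that is, the lower limit of
`(f x' - f x - ⟪v, x' - x⟫) / ‖x' - x‖` for `x' → x`, `x' ≠ x`, is nonnegative. -/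
def regularSubdiff (f : E → EReal) (x : E) : Set E :=
  {v | f x ≠ ⊥ ∧ f x ≠ ⊤ ∧ ∀ ε : ℝ, 0 < ε → ∀ᶠ x' in 𝓝 x,
    f x + ((inner ℝ v (x' - x) - ε * ‖x' - x‖ : ℝ) : EReal) ≤ f x'}

/-- The basic (limiting, Mordukhovich) subdifferential. -/
def basicSubdiff (f : E → EReal) (x : E) : Set E :=
  {v | f x ≠ ⊥ ∧ f x ≠ ⊤ ∧ ∃ (y : ℕ → E) (u : ℕ → E),
    Tendsto y atTop (𝓝 x) ∧ Tendsto (fun k => f (y k)) atTop (𝓝 (f x)) ∧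
    (∀ k, u k ∈ regularSubdiff f (y k)) ∧ Tendsto u atTop (𝓝 v)}

/-- The class `Υ_η`, `η ∈ (0, ∞]`, of desingularizing functions on `[0, η)`. -/
structure IsDesingularizing (η : EReal) (φ : ℝ → ℝ) : Prop where
  continuousOn : ContinuousOn φ {s : ℝ | 0 ≤ s ∧ (s : EReal) < η}
  concaveOn : ConcaveOn ℝ {s : ℝ | 0 ≤ s ∧ (s : EReal) < η} φ
  nonneg : ∀ s : ℝ, 0 ≤ s → (s : EReal) < η → 0 ≤ φ s
  contDiffOn : ContDiffOn ℝ 1 φ {s : ℝ | 0 < s ∧ (s : EReal) < η}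
  map_zero : φ 0 = 0
  deriv_pos : ∀ s : ℝ, 0 < s → (s : EReal) < η → 0 < deriv φ s

/-- `f` has the KL property at `a` with the desingularizing function `φ ∈ Υ_η`:
`φ'(f x - f a) * dist (0, ∂f x) ≥ 1` for all `x` near `a` with `f a < f x < f a + η`.
The distance to the empty set is `∞`. -/
def HasKLPropertyWith (f : E → EReal) (a : E) (η : EReal) (φ : ℝ → ℝ) : Prop :=
  0 < η ∧ IsDesingularizing η φ ∧ ∃ V ∈ 𝓝 a, ∀ x ∈ V, f a < f x → f x < f a + η →
    1 ≤ ENNReal.ofReal (deriv φ (f x - f a).toReal) * Metric.infEDist 0 (basicSubdiff f x)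

/-- The KL property of exponent `γ ∈ [0, 1)` at `a`: `φ t = c * t ^ (1 - γ)` can be chosen. -/
def HasKLPropertyOfExponentAt (f : E → EReal) (γ : ℝ) (a : E) : Prop :=
  ∃ (η : EReal) (c : ℝ), 0 < c ∧ HasKLPropertyWith f a η (fun t => c * t ^ (1 - γ))

/-- A proper lower semicontinuous function on the open set `U` is a KL function of exponent `γ`
if it has the KL property of exponent `γ` at each point of `dom ∂f`. All the notions involved are
local, so that values of `f` outside `U` play no role; for a function defined on the whole space,
`U = Set.univ`. -/
structure IsKLFunctionOfExponentOn (U : Set E) (f : E → EReal) (γ : ℝ) : Prop where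
  exponent_mem : γ ∈ Ico (0 : ℝ) 1
  proper : (∃ x ∈ U, f x < ⊤) ∧ ∀ x ∈ U, f x ≠ ⊥
  lsc : LowerSemicontinuousOn f U
  kl : ∀ a ∈ U, (basicSubdiff f a).Nonempty → HasKLPropertyOfExponentAt f γ a

end Subdifferential

/-! ### Matrices and the function family `ℒ` -/

/-- `ℝ^{a × b}` with the trace inner product and the Frobenius norm. -/
abbrev FMat (a b : ℕ) : Type := EuclideanSpace ℝ (Fin a × Fin b)

/-- The entrywise absolute value `|z|`. -/
def FMat.abs {a b : ℕ} (z : FMat a b) : FMat a b := WithLp.toLp 2 fun ij => |z ij|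

/-- `ϑ(z) = ∑ i j, θ (z i j)`. -/
def vartheta (θ : ℝ → ℝ) {a b : ℕ} (z : FMat a b) : ℝ := ∑ ij, θ (z ij)

/-- `∇ϑ(z)`, the matrix with entries `θ' (z i j)`. -/
def gradVartheta (θ : ℝ → ℝ) {a b : ℕ} (z : FMat a b) : FMat a b :=
  WithLp.toLp 2 fun ij => deriv θ (z ij)

/-- `y ∘ ∂|z|`, the set of the matrices `v` with `v i j ∈ y i j * ∂|·|(z i j)`. -/
def hadamardAbsSubdiff {a b : ℕ} (y z : FMat a b) : Set (FMat a b) :=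
  {v | ∀ ij, ∃ s ∈ basicSubdiff (fun t : ℝ => ((|t| : ℝ) : EReal)) (z ij), v ij = y ij * s}

/-- The family `ℒ`: concave functions that are differentiable on an open interval containing
`[0, ∞)` with a strictly continuous (locally Lipschitz) derivative there, with `θ' ≥ 0` on
`[0, ∞)` and `θ 0 = 0`. -/
def MemFamilyL (θ : ℝ → ℝ) : Prop :=
  (∃ I : Set ℝ, IsOpen I ∧ I.OrdConnected ∧ Ici 0 ⊆ I ∧ ConcaveOn ℝ I θ ∧
    DifferentiableOn ℝ θ I ∧ LocallyLipschitzOn I (deriv θ)) ∧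
  (∀ t : ℝ, 0 ≤ t → 0 ≤ deriv θ t) ∧ θ 0 = 0

/-! ### The composite model -/

/-- The data of the problem `min Θ(x) = ϑ(|F x|) + ν ψ(T x) + lam h(x)`; the maps `F` and `T` only
matter on the set `O`. -/
structure CompositeModel (X : Type*) [NormedAddCommGroup X] [InnerProductSpace ℝ X]
    (m n p q : ℕ) where
  h : X → EReal
  O : Set X
  F : X → FMat m n
  T : X → FMat p q
  ψ : FMat p q → ℝ
  θ : ℝ → ℝ
  ν : ℝ
  lam : ℝ

namespace CompositeModel

variable {X : Type*} [NormedAddCommGroup X] [InnerProductSpace ℝ X] {m n p q : ℕ}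

/-- The basic assumption on the model. -/
structure BasicAssumption (M : CompositeModel X m n p q) : Prop where
  h_proper : (effDom M.h).Nonempty
  h_lsc : LowerSemicontinuous M.h
  /-- `h` is convex: its epigraph is a convex set. -/
  h_convex : Convex ℝ {z : X × ℝ | M.h z.1 ≤ (z.2 : EReal)}
  /-- `h` is strictly continuous relative to its domain. -/
  h_strictCont : LocallyLipschitzOn (effDom M.h) (fun x => (M.h x).toReal)
  h_bddBelow : ∃ c : ℝ, ∀ x, (c : EReal) ≤ M.h x
  O_open : IsOpen M.O
  dom_subset : effDom M.h ⊆ M.O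
  F_contDiff : ContDiffOn ℝ 1 M.F M.O
  T_contDiff : ContDiffOn ℝ 1 M.T M.O
  ψ_convex : ConvexOn ℝ univ M.ψ
  ψ_bddBelow : BddBelow (range M.ψ)
  θ_mem : MemFamilyL M.θ

/-- The objective function `Θ`. -/
def obj (M : CompositeModel X m n p q) (x : X) : EReal :=
  ((vartheta M.θ (M.F x).abs + M.ν * M.ψ (M.T x) : ℝ) : EReal) + (M.lam : EReal) * M.h x

/-- The linearization `ℓ_F(x; z) = F z + F'(z) (x - z)`. -/
def linF (M : CompositeModel X m n p q) (x z : X) : FMat m n :=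
  M.F z + fderiv ℝ M.F z (x - z)

/-- The linearization `ℓ_T(x; z) = T z + T'(z) (x - z)`. -/
def linT (M : CompositeModel X m n p q) (x z : X) : FMat p q :=
  M.T z + fderiv ℝ M.T z (x - z)

/-- The constant `C = ϑ(|F z|) - ⟪∇ϑ(|F z|), |F z|⟫`. -/
def surrogateConst (M : CompositeModel X m n p q) (z : X) : ℝ :=
  vartheta M.θ (M.F z).abs - inner ℝ (gradVartheta M.θ (M.F z).abs) (M.F z).abs

/-- The objective function of the subproblem at the iterate `z` with the operator `Q`:
`⟪∇ϑ(|F z|), |ℓ_F(x; z)|⟫ + ν ψ(ℓ_T(x; z)) + lam h(x) + (1/2) ⟪x - z, Q (x - z)⟫ + C`. -/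
def surrogate (M : CompositeModel X m n p q) (z : X) (Q : X →ₗ[ℝ] X) (x : X) : EReal :=
  ((inner ℝ (gradVartheta M.θ (M.F z).abs) (M.linF x z).abs + M.ν * M.ψ (M.linT x z)
      + 1 / 2 * inner ℝ (x - z) (Q (x - z)) + M.surrogateConst z : ℝ) : EReal)
    + (M.lam : EReal) * M.h x

/-- Stationary points:
`0 ∈ ∇F(x) [∇ϑ(|F x|) ∘ ∂|F x|] + ν ∇T(x) ∂ψ(T x) + lam ∂h(x)` with `x ∈ dom h`, where `∇F(x)` is
the adjoint of the derivative `F'(x)`. -/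
def IsStationary [FiniteDimensional ℝ X] (M : CompositeModel X m n p q) (x : X) : Prop :=
  x ∈ effDom M.h ∧
  (0 : X) ∈
    LinearMap.adjoint (fderiv ℝ M.F x : X →ₗ[ℝ] FMat m n) ''
        hadamardAbsSubdiff (gradVartheta M.θ (M.F x).abs) (M.F x)
      + M.ν • (LinearMap.adjoint (fderiv ℝ M.T x : X →ₗ[ℝ] FMat p q) ''
        basicSubdiff (fun y => (M.ψ y : EReal)) (M.T x))
      + M.lam • basicSubdiff M.h x

/-- The space `X × X × ℝ` of the triples `w = (x, z, t)` with its Euclidean structure. -/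
abbrev Triple (X : Type*) : Type _ := WithLp 2 (X × WithLp 2 (X × ℝ))

/-- The potential function
`Ξ(x, z, t) = ϑ(|ℓ_F(x; z)|) + ν ψ(ℓ_T(x; z)) + lam h(x) + (γ/2) ‖x - z‖² + t²`. -/
def potential (M : CompositeModel X m n p q) (γ : ℝ) (w : Triple X) : EReal :=
  ((vartheta M.θ (M.linF w.fst w.snd.fst).abs + M.ν * M.ψ (M.linT w.fst w.snd.fst)
      + γ / 2 * ‖w.fst - w.snd.fst‖ ^ 2 + w.snd.snd ^ 2 : ℝ) : EReal)
    + (M.lam : EReal) * M.h w.fst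

/-- The open set of the triples `(x, z, t)` with `z ∈ O`, on which the potential is defined. -/
def potentialDomain (M : CompositeModel X m n p q) : Set (Triple X) := {w | w.snd.fst ∈ M.O}

/-- An infinite run of the inexact proximal majorization-minimization algorithm. The inner loop at
iteration `k` makes the trials `j = 0, …, last k`; values of `γ k j`, `Q k j`, `trial k j` and
`opt k j` for `j > last k` are irrelevant. -/
structure IPMMRun (M : CompositeModel X m n p q) where
  ϱ : ℝ
  γlo : ℝ
  γhi : ℝ
  μbar : ℝ
  μ : ℕ → ℝ
  one_lt_ϱ : 1 < ϱ
  γlo_pos : 0 < γlo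
  γlo_lt_γhi : γlo < γhi
  μbar_pos : 0 < μbar
  μ_mem : ∀ k, μ k ∈ Ioc 0 μbar
  /-- The iterates. -/
  x : ℕ → X
  /-- The number of the accepted trial. -/
  last : ℕ → ℕ
  γ : ℕ → ℕ → ℝ
  Q : ℕ → ℕ → X →ₗ[ℝ] X
  /-- The inexact minimizers of the subproblems. -/
  trial : ℕ → ℕ → X
  /-- The exact minimizers of the subproblems. -/
  opt : ℕ → ℕ → X
  x_zero_mem : x 0 ∈ M.O
  γ_zero_mem : ∀ k, γ k 0 ∈ Icc γlo γhi
  Q_symm : ∀ k, ∀ j ≤ last k, (Q k j).IsSymmetric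
  /-- `γ k j • 1 ≼ Q k j`. -/
  Q_lower : ∀ k, ∀ j ≤ last k, ∀ u, γ k j * ‖u‖ ^ 2 ≤ inner ℝ u (Q k j u)
  /-- `Q k j ≼ ϱ γ k j • 1`. -/
  Q_upper : ∀ k, ∀ j ≤ last k, ∀ u, inner ℝ u (Q k j u) ≤ ϱ * γ k j * ‖u‖ ^ 2
  opt_isMin : ∀ k, ∀ j ≤ last k, ∀ y,
    M.surrogate (x k) (Q k j) (opt k j) ≤ M.surrogate (x k) (Q k j) y
  /-- The first inexactness condition. -/
  inexact_decrease : ∀ k, ∀ j ≤ last k,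
    M.surrogate (x k) (Q k j) (trial k j) < M.obj (x k)
  /-- The second inexactness condition. -/
  inexact_gap : ∀ k, ∀ j ≤ last k,
    M.surrogate (x k) (Q k j) (trial k j) - M.surrogate (x k) (Q k j) (opt k j)
      ≤ ((μ k / 2 : ℝ) : EReal) * (M.obj (x k) - M.surrogate (x k) (Q k j) (trial k j))
  /-- The trials before the last one are rejected, and `γ` is enlarged. -/
  rejected : ∀ k, ∀ j < last k,
    M.surrogate (x k) (Q k j) (trial k j) < M.obj (trial k j) ∧ γ k (j + 1) = ϱ * γ k j
  /-- The last trial is accepted. -/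
  accepted : ∀ k, M.obj (trial k (last k)) ≤ M.surrogate (x k) (Q k (last k)) (trial k (last k))
  x_succ : ∀ k, x (k + 1) = trial k (last k)

end CompositeModel

end

/-! Write `δ k` for the decrease of the objective between consecutive iterates. Concavity of `ϑ` on
nonnegative matrices makes the surrogate a majorant of `Θ` up to the linearization errors of `F` and
`T`, which are quadratic on compact convex subsets of `dom h`. Hence a trial can be rejected only
while its proximal parameter is below a fixed constant, and the accepted parameters are bounded.
Quadratic growth of the subproblem at its exact minimizer, combined with the two inexactness
conditions, bounds both the step and the distance to that minimizer by a multiple of `√(δ k)`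
(`exists_descent`).

An inexact iterate carries no small subgradient, but the exact minimizer `a` does: the optimality
conditions of the subproblem yield a subgradient of the potential at `(a, x, t)` of size `O(‖a - x‖
+ |t|)`. The third variable supplies the missing height. With `t ^ 2` a suitable multiple of `δ k`,
the potential at this triple is at least the next objective value and at most the current one plus
`O(δ k)` (`exists_test_triples`). The triples cluster only at diagonal points `(x, x, 0)`, where the
potential equals the limit `l` of the objective values.

The KL inequality there becomes `(Θ(x^{k+1}) - l) ^ e ≤ C √(Θ(x^k) - Θ(x^{k+1}))` for large `k`
(`exists_recursion`). This recursion for real numbers does the rest: the square roots are summable,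
so the iterates form a Cauchy sequence, and the two rates follow from `linear_rate_of_rpow_le` and
`sublinear_rate_of_rpow_le`. The limit minimizes its own surrogate for one fixed multiple of the
identity, hence is stationary. -/

/-! ### Recursive inequalities for real sequences -/

section Sequences

/-- The tangent inequality for the concave function `s ↦ s ^ p`, `p ∈ [0, 1]`. -/
lemma rpow_sub_rpow_ge_of_concave {a b p : ℝ} (ha : 0 < a) (hb : 0 < b) (hp0 : 0 ≤ p)
    (hp1 : p ≤ 1) : p * a ^ (p - 1) * (a - b) ≤ a ^ p - b ^ p := by
  have h := rpow_one_add_le_one_add_mul_self (s := b / a - 1) (by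
    have : 0 < b / a := by positivity
    linarith) hp0 hp1
  rw [add_sub_cancel, Real.div_rpow hb.le ha.le, div_le_iff₀ (by positivity)] at h
  have h2 : a ^ (p - 1) = a ^ p / a := by rw [Real.rpow_sub ha, Real.rpow_one]
  rw [h2]
  have h3 : (1 + p * (b / a - 1)) * a ^ p = a ^ p - p * (a ^ p / a) * (a - b) := by
    field_simp; ring
  linarith

/-- The tangent inequality for the convex function `s ↦ s ^ (-p)`, `p ≥ 0`. -/
lemma rpow_neg_sub_rpow_neg_ge {a b p : ℝ} (ha : 0 < a) (hb : 0 < b) (hp0 : 0 ≤ p) :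
    p * a ^ (-p - 1) * (a - b) ≤ b ^ (-p) - a ^ (-p) := by
  have hba : 0 < b / a := by positivity
  have h : 1 + p * (1 - b / a) ≤ (b / a) ^ (-p) := by
    rw [Real.rpow_def_of_pos hba]
    have h1 := Real.add_one_le_exp (Real.log (b / a) * -p)
    have h2 := Real.log_le_sub_one_of_pos hba
    nlinarith
  rw [Real.div_rpow hb.le ha.le, le_div_iff₀ (by positivity)] at h
  have h2 : a ^ (-p - 1) = a ^ (-p) / a := by rw [Real.rpow_sub ha, Real.rpow_one]
  rw [h2]
  have h3 : (1 + p * (1 - b / a)) * a ^ (-p) = a ^ (-p) + p * (a ^ (-p) / a) * (a - b) := by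
    field_simp
  linarith

variable {r : ℕ → ℝ} {C e : ℝ} {N : ℕ}

/-- The desingularizing argument in scalar form: concavity of `s ^ (1 - e)` and the recursion give
`d (k + 1) ^ 2 ≤ d k * (B * Δ)`, where `Δ` is a telescoping difference, and the arithmetic-geometric
mean inequality splits the product. -/
lemma summable_sqrt_sub_of_rpow_le (he0 : 0 < e) (he1 : e < 1) (hC : 0 < C)
    (hpos : ∀ k ≥ N, 0 < r k) (hanti : ∀ k ≥ N, r (k + 1) ≤ r k)
    (h : ∀ k ≥ N, r (k + 1) ^ e ≤ C * √(r k - r (k + 1))) :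
    Summable fun k => √(r k - r (k + 1)) := by
  set d : ℕ → ℝ := fun k => √(r k - r (k + 1)) with hd
  have he : 0 < 1 - e := by linarith
  set B : ℝ := C / (1 - e) with hB
  have hBpos : 0 < B := by positivity
  have hd0 : ∀ k, 0 ≤ d k := fun k => Real.sqrt_nonneg _
  have key : ∀ k ≥ N,
      2 * d (k + 1) ≤ d k + B * (r (k + 1) ^ (1 - e) - r (k + 2) ^ (1 - e)) := by
    intro k hk
    have p1 := hpos (k + 1) (by omega)
    have p2 := hpos (k + 2) (by omega)
    have t := rpow_sub_rpow_ge_of_concave p1 p2 he.le (by linarith)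
    have hsq : d (k + 1) ^ 2 = r (k + 1) - r (k + 2) :=
      Real.sq_sqrt (sub_nonneg.2 (hanti (k + 1) (by omega)))
    have hk1 : r (k + 1) ^ e ≤ C * d k := h k hk
    have e1 : (1 - e - 1 : ℝ) = -e := by ring
    rw [e1, Real.rpow_neg p1.le, ← hsq] at t
    have hpe : 0 < r (k + 1) ^ e := by positivity
    set Δ := r (k + 1) ^ (1 - e) - r (k + 2) ^ (1 - e)
    have t2 : (1 - e) * d (k + 1) ^ 2 ≤ Δ * r (k + 1) ^ e := by
      rw [← div_le_iff₀ hpe]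
      calc _ = (1 - e) * (r (k + 1) ^ e)⁻¹ * d (k + 1) ^ 2 := by ring
        _ ≤ Δ := t
    have hΔ : 0 ≤ Δ := le_trans (by positivity) t
    have t3 : d (k + 1) ^ 2 ≤ d k * (B * Δ) := by
      have : (1 - e) * d (k + 1) ^ 2 ≤ (1 - e) * (d k * (B * Δ)) := by
        calc _ ≤ Δ * r (k + 1) ^ e := t2
          _ ≤ Δ * (C * d k) := by gcongr
          _ = _ := by rw [hB]; field_simp
      exact le_of_mul_le_mul_left this he
    have hBΔ : 0 ≤ B * Δ := by positivity
    refine abs_le_of_sq_le_sq' ?_ (by linarith [hd0 k]) |>.2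
    nlinarith [sq_nonneg (d k - B * Δ)]
  rw [← summable_nat_add_iff (N + 1)]
  refine summable_of_sum_range_le (c := d N + B * r (N + 1) ^ (1 - e)) (fun n => hd0 _) ?_
  -- Of the two copies of `d (k + 1)` on the left of `key`, one enters the sum and the other is
  -- carried on to pay for the next `d k`.
  have ind : ∀ n, ∑ i ∈ Finset.range n, d (i + (N + 1)) + d (N + n)
      + B * r (N + n + 1) ^ (1 - e) ≤ d N + B * r (N + 1) ^ (1 - e) := by
    intro n
    induction n with
    | zero => simp
    | succ n ih =>
      rw [Finset.sum_range_succ]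
      have k1 := key (N + n) (by omega)
      have e1 : n + (N + 1) = N + n + 1 := by ring
      have e2 : N + (n + 1) = N + n + 1 := by ring
      rw [e1, e2]
      have e3 : N + n + 1 + 1 = N + n + 2 := by ring
      rw [e3]
      linarith
  intro n
  have h1 := ind n
  have h2 := hd0 (N + n)
  have h3 : 0 ≤ B * r (N + n + 1) ^ (1 - e) :=
    mul_nonneg hBpos.le (Real.rpow_nonneg (hpos _ (by omega)).le _)
  linarith

lemma rpow_two_mul_le_of_rpow_le (hpos : ∀ k ≥ N, 0 < r k)
    (hanti : ∀ k ≥ N, r (k + 1) ≤ r k)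
    (h : ∀ k ≥ N, r (k + 1) ^ e ≤ C * √(r k - r (k + 1))) :
    ∀ k ≥ N, r (k + 1) ^ (2 * e) ≤ C ^ 2 * (r k - r (k + 1)) := by
  intro k hk
  have p1 := hpos (k + 1) (by omega)
  have h1 := h k hk
  have h2 : (r (k + 1) ^ e) ^ 2 ≤ (C * √(r k - r (k + 1))) ^ 2 := by gcongr
  rw [mul_pow, Real.sq_sqrt (sub_nonneg.2 (hanti k hk)), ← Real.rpow_natCast,
    ← Real.rpow_mul p1.le] at h2
  rwa [show (2 * e : ℝ) = e * ((2 : ℕ) : ℝ) by push_cast; ring]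

/-- Once `r ≤ 1`, the exponent `2 * e ≤ 1` gives `r (k + 1) ≤ r (k + 1) ^ (2 * e) ≤ B * (r k - r (k
+ 1))`, a contraction with factor `B / (1 + B)`. -/
lemma linear_rate_of_rpow_le (he1 : e ≤ 1 / 2) (hC : 0 < C)
    (hpos : ∀ k ≥ N, 0 < r k) (hanti : ∀ k ≥ N, r (k + 1) ≤ r k)
    (hlim : Tendsto r atTop (𝓝 0))
    (h : ∀ k ≥ N, r (k + 1) ^ e ≤ C * √(r k - r (k + 1))) :
    ∃ A : ℝ, 0 < A ∧ ∃ ρ : ℝ, ρ ∈ Ioo (0 : ℝ) 1 ∧ ∀ᶠ k : ℕ in atTop, r k ≤ A * ρ ^ k := by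
  have h' := rpow_two_mul_le_of_rpow_le hpos hanti h
  obtain ⟨N', hN'⟩ := eventually_atTop.1 (hlim.eventually (ge_mem_nhds (by norm_num : (0 : ℝ) < 1)))
  set P := max N N'
  set B := C ^ 2
  have hB : 0 < B := by positivity
  set ρ := B / (1 + B) with hρdef
  have hρ0 : 0 < ρ := by positivity
  have hρ1 : ρ < 1 := by rw [hρdef, div_lt_one (by positivity)]; linarith
  have hP : N ≤ P := le_max_left _ _
  have hP' : N' ≤ P := le_max_right _ _
  have step : ∀ k ≥ P, r (k + 1) ≤ ρ * r k := by
    intro k hk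
    have p1 := hpos (k + 1) (by omega)
    have h1 : r (k + 1) ≤ r (k + 1) ^ (2 * e) := by
      conv_lhs => rw [← Real.rpow_one (r (k + 1))]
      exact Real.rpow_le_rpow_of_exponent_ge p1 (hN' (k + 1) (by omega)) (by linarith)
    have h2 := h' k (by omega)
    rw [hρdef, div_mul_eq_mul_div, le_div_iff₀ (by positivity)]
    nlinarith
  have geo : ∀ n, r (P + n) ≤ r P * ρ ^ n := by
    intro n
    induction n with
    | zero => simp
    | succ n ih =>
      calc r (P + (n + 1)) ≤ ρ * r (P + n) := step (P + n) (by omega)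
        _ ≤ ρ * (r P * ρ ^ n) := by gcongr
        _ = _ := by ring
  have hrP := hpos P hP
  refine ⟨r P / ρ ^ P, by positivity, ρ, ⟨hρ0, hρ1⟩, ?_⟩
  filter_upwards [eventually_ge_atTop P] with k hk
  obtain ⟨n, rfl⟩ := Nat.exists_eq_add_of_le hk
  calc _ ≤ _ := geo n
    _ = _ := by rw [pow_add]; field_simp

/-- The quantity `r k ^ (-p)` with `p = 2 * e - 1` increases by at least a fixed amount per step, so
it grows linearly; inverting the power gives the rate. -/
lemma sublinear_rate_of_rpow_le (he0 : 1 / 2 < e) (hC : 0 < C)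
    (hpos : ∀ k ≥ N, 0 < r k) (hanti : ∀ k ≥ N, r (k + 1) ≤ r k)
    (h : ∀ k ≥ N, r (k + 1) ^ e ≤ C * √(r k - r (k + 1))) :
    ∃ A : ℝ, 0 < A ∧ ∀ᶠ k : ℕ in atTop, r k ≤ A * (k : ℝ) ^ (-(1 / (2 * e - 1))) := by
  have h' := rpow_two_mul_le_of_rpow_le hpos hanti h
  set p := 2 * e - 1 with hp
  have hp0 : 0 < p := by linarith
  set B := C ^ 2
  have hB : 0 < B := by positivity
  have hrN := hpos N le_rfl
  have hle : ∀ n, r (N + n) ≤ r N := by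
    intro n
    induction n with
    | zero => simp
    | succ n ih => exact (hanti (N + n) (by omega)).trans ih
  -- The first entry is the gain when `r` is at most halved, where the tangent inequality is
  -- effective; the second is the gain when `r` falls below half, where `r ^ (-p)` is multiplied by
  -- more than `2 ^ p`.
  set c := min (p * 2 ^ (-(2 * e)) / B) ((2 ^ p - 1) * r N ^ (-p)) with hc
  have h2p : (1 : ℝ) < 2 ^ p := Real.one_lt_rpow (by norm_num) hp0
  have hc0 : 0 < c := lt_min (by positivity) (mul_pos (by linarith) (by positivity))
  have step : ∀ k ≥ N, r k ^ (-p) + c ≤ r (k + 1) ^ (-p) := by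
    intro k hk
    have pa := hpos k hk
    have pb := hpos (k + 1) (by omega)
    obtain ⟨n, rfl⟩ := Nat.exists_eq_add_of_le hk
    have hkN := hle n
    set a := r (N + n)
    set b := r (N + n + 1)
    rcases le_or_gt (a / 2) b with hab | hab
    · have t := rpow_neg_sub_rpow_neg_ge pa pb hp0.le
      have h1 := h' (N + n) hk
      have h2 : a ^ (2 * e) * 2 ^ (-(2 * e)) ≤ b ^ (2 * e) := by
        calc a ^ (2 * e) * 2 ^ (-(2 * e)) = (a / 2) ^ (2 * e) := by
              rw [Real.div_rpow pa.le (by norm_num), Real.rpow_neg (by norm_num)]; rfl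
          _ ≤ b ^ (2 * e) := Real.rpow_le_rpow (by positivity) hab (by linarith)
      have e1 : -p - 1 = -(2 * e) := by rw [hp]; ring
      rw [e1, Real.rpow_neg pa.le] at t
      have hA : 0 < a ^ (2 * e) := by positivity
      have h3 : p * 2 ^ (-(2 * e)) / B ≤ p * (a ^ (2 * e))⁻¹ * (a - b) := by
        rw [div_le_iff₀ hB]
        have : a ^ (2 * e) * 2 ^ (-(2 * e)) ≤ B * (a - b) := h2.trans h1
        calc p * 2 ^ (-(2 * e))
            = p * (a ^ (2 * e))⁻¹ * (a ^ (2 * e) * 2 ^ (-(2 * e))) := by field_simp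
          _ ≤ p * (a ^ (2 * e))⁻¹ * (B * (a - b)) := by gcongr
          _ = _ := by ring
      have := min_le_left (p * 2 ^ (-(2 * e)) / B) ((2 ^ p - 1) * r N ^ (-p))
      linarith
    · have h1 : 2 ^ p * a ^ (-p) ≤ b ^ (-p) := by
        calc 2 ^ p * a ^ (-p) = (a / 2) ^ (-p) := by
              rw [Real.div_rpow pa.le (by norm_num), Real.rpow_neg (by norm_num : (0 : ℝ) ≤ 2)]
              field_simp
          _ ≤ b ^ (-p) := Real.rpow_le_rpow_of_nonpos pb hab.le (by linarith)
      have h2 : r N ^ (-p) ≤ a ^ (-p) := Real.rpow_le_rpow_of_nonpos pa hkN (by linarith)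
      have := min_le_right (p * 2 ^ (-(2 * e)) / B) ((2 ^ p - 1) * r N ^ (-p))
      nlinarith
  have lin : ∀ n : ℕ, c * n ≤ r (N + n) ^ (-p) := by
    intro n
    induction n with
    | zero => simpa using (Real.rpow_nonneg hrN.le _)
    | succ n ih =>
      have := step (N + n) (by omega)
      push_cast
      rw [← add_assoc]
      linarith
  refine ⟨(c / 2) ^ (-(1 / p)), by positivity, ?_⟩
  -- From here on `k - N ≥ k / 2`, which is why `c / 2` appears in the constant.
  filter_upwards [eventually_ge_atTop (2 * N + 1)] with k hk
  obtain ⟨n, rfl⟩ := Nat.exists_eq_add_of_le (show N ≤ k by omega)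
  have hr := hpos (N + n) (by omega)
  have hkpos : (0 : ℝ) < ((N + n : ℕ) : ℝ) := by exact_mod_cast (by omega : 0 < N + n)
  have h1 : c / 2 * ((N + n : ℕ) : ℝ) ≤ r (N + n) ^ (-p) := by
    refine le_trans ?_ (lin n)
    have : ((N + n : ℕ) : ℝ) ≤ 2 * n := by exact_mod_cast (by omega : N + n ≤ 2 * n)
    nlinarith
  rw [← Real.mul_rpow (by positivity) hkpos.le]
  have h2 := Real.rpow_le_rpow_of_nonpos (by positivity) h1
    (show -(1 / p) ≤ 0 by have : 0 < 1 / p := by positivity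
                          linarith)
  rwa [← Real.rpow_mul hr.le, show -p * -(1 / p) = 1 by field_simp, Real.rpow_one] at h2

end Sequences

/-! ### Subgradients of convex functions -/

section ConvexSubgradients

variable {E X Y : Type*} [NormedAddCommGroup E] [InnerProductSpace ℝ E]
  [NormedAddCommGroup X] [InnerProductSpace ℝ X]
  [NormedAddCommGroup Y] [InnerProductSpace ℝ Y]

/-- `v` is a subgradient at `x` of the real-valued function `g` on the set `D`, in the sense of
convex analysis. -/
def IsSubgradientOn (D : Set E) (g : E → ℝ) (x v : E) : Prop :=
  ∀ y ∈ D, g x + inner ℝ v (y - x) ≤ g y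

/-- A Fermat rule with the sum and the chain rule built in: if `g (b + A x) + f x` is minimal on
`D` at `a`, then `g` has a subgradient `u` at `b + A a` such that `⟪u, A x⟫ + f x` is minimal on
`D` at `a`. -/
theorem exists_isSubgradientOn_of_isMinOn [CompleteSpace Y] {g : Y → ℝ} {f : X → ℝ} {D : Set X}
    (hg : ConvexOn ℝ univ g) (hgc : Continuous g) (hf : ConvexOn ℝ D f) (A : X →ₗ[ℝ] Y) (b : Y)
    {a : X} (ha : a ∈ D) (hmin : ∀ x ∈ D, g (b + A a) + f a ≤ g (b + A x) + f x) :
    ∃ u : Y, IsSubgradientOn univ g (b + A a) u ∧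
      ∀ x ∈ D, inner ℝ u (A a) + f a ≤ inner ℝ u (A x) + f x := by
  set c := b + A a with hc
  -- Separation of the open strict epigraph of `g` from the image under `x ↦ b + A x` of the
  -- hypograph of `g c + f a - f`; minimality at `a` is exactly disjointness.
  set S : Set (Y × ℝ) := {z | g z.1 < z.2}
  set P : Set (Y × ℝ) := {z | ∃ x ∈ D, z.1 = b + A x ∧ z.2 ≤ g c + f a - f x}
  have hS : Convex ℝ S := by
    have := hg.convex_strict_epigraph
    simpa using this
  have hSo : IsOpen S := isOpen_lt (hgc.comp continuous_fst) continuous_snd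
  have hP : Convex ℝ P := by
    rintro ⟨y1, s1⟩ ⟨x1, hx1, h1, h1'⟩ ⟨y2, s2⟩ ⟨x2, hx2, h2, h2'⟩ α β hα hβ hαβ
    refine ⟨α • x1 + β • x2, hf.1 hx1 hx2 hα hβ hαβ, ?_, ?_⟩
    · simp only [Prod.smul_mk, Prod.mk_add_mk] at h1 h2 ⊢
      rw [h1, h2, map_add, map_smul, map_smul]
      calc _ = (α + β) • b + (α • A x1 + β • A x2) := by rw [add_smul]; simp only [smul_add]; abel
        _ = _ := by rw [hαβ, one_smul]
    · have := hf.2 hx1 hx2 hα hβ hαβ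
      simp only [Prod.smul_mk, Prod.mk_add_mk, smul_eq_mul] at h1' h2' this ⊢
      have e : g c + f a = α * (g c + f a) + β * (g c + f a) := by rw [← add_mul, hαβ, one_mul]
      nlinarith [mul_le_mul_of_nonneg_left h1' hα, mul_le_mul_of_nonneg_left h2' hβ]
  have hdisj : Disjoint S P := by
    rw [Set.disjoint_left]
    rintro ⟨y, s⟩ hs ⟨x, hx, h1, h2⟩
    simp only [S, mem_ofPred_eq] at hs h1 h2
    have := hmin x hx
    rw [h1] at hs
    linarith
  obtain ⟨φ, s, hφS, hφP⟩ := geometric_hahn_banach_open hS hSo hP hdisj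
  set α : ℝ := φ (0, 1) with hα
  have hφ : ∀ (y : Y) (t : ℝ), φ (y, t) = φ (y, 0) + t * α := by
    intro y t
    have : (y, t) = (y, (0 : ℝ)) + t • ((0 : Y), (1 : ℝ)) := by ext <;> simp
    rw [this, map_add, map_smul, smul_eq_mul]
  have hPle : ∀ x ∈ D, s ≤ φ (b + A x, 0) + (g c + f a - f x) * α := by
    intro x hx
    rw [← hφ]
    exact hφP _ ⟨x, hx, rfl, le_rfl⟩
  have hSle : ∀ y, φ (y, 0) + g y * α ≤ s := by
    intro y
    rw [← hφ]
    have hcl : (y, g y) ∈ closure S := by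
      rw [mem_closure_iff_seq_limit]
      refine ⟨fun n => (y, g y + 1 / ((n : ℝ) + 1)), fun n => ?_, ?_⟩
      · have : (0 : ℝ) < 1 / ((n : ℝ) + 1) := by positivity
        simp only [S, mem_ofPred_eq]
        linarith
      · have := (tendsto_one_div_add_atTop_nhds_zero_nat (𝕜 := ℝ)).const_add (g y)
        rw [add_zero] at this
        exact tendsto_const_nhds.prodMk_nhds this
    have hsub : closure S ⊆ {z | φ z ≤ s} :=
      closure_minimal (fun z hz => (hφS z hz).le) (isClosed_le φ.continuous continuous_const)
    exact hsub hcl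
  -- The hyperplane is not vertical: the point `(c, g c)` lies in `P` and `(c, g c + 1)` in `S`.
  -- Normalizing by `-α` turns the functional into a subgradient.
  have hαneg : α < 0 := by
    have h1 := hφS (c, g c + 1) (by simp only [S, mem_ofPred_eq]; linarith)
    have h2 := hPle a ha
    rw [hφ] at h1
    rw [← hc] at h2
    linarith
  set ψ : StrongDual ℝ Y := (-α)⁻¹ • (φ.comp (ContinuousLinearMap.inl ℝ Y ℝ))
  set u : Y := (InnerProductSpace.toDual ℝ Y).symm ψ
  have hu : ∀ y, inner ℝ u y = (-α)⁻¹ * φ (y, 0) := by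
    intro y
    rw [InnerProductSpace.toDual_symm_apply]
    simp [ψ]
  have hna : 0 < -α := by linarith
  have hφu : ∀ y, φ (y, 0) = -α * inner ℝ u y := by
    intro y
    rw [hu, mul_inv_cancel_left₀ hna.ne']
  have h0 := hPle a ha
  rw [← hc, hφu] at h0
  refine ⟨u, fun y _ => ?_, fun x hx => ?_⟩
  · have h1 := hSle y
    rw [hφu] at h1
    rw [inner_sub_right]
    have : 0 ≤ -α * (g y - (g c + (inner ℝ u y - inner ℝ u c))) := by nlinarith
    have := nonneg_of_mul_nonneg_right this hna
    linarith
  · have h1 := hPle x hx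
    have h2 := hSle c
    rw [hφu] at h1 h2
    rw [hc, inner_add_right] at h2
    rw [inner_add_right] at h1
    have : 0 ≤ -α * (inner ℝ u (A x) + f x - (inner ℝ u (A a) + f a)) := by
      rw [← hc] at h2
      nlinarith
    have := nonneg_of_mul_nonneg_right this hna
    linarith

theorem exists_isSubgradientOn [CompleteSpace Y] {g : Y → ℝ}
    (hg : ConvexOn ℝ univ g) (hgc : Continuous g) (y : Y) :
    ∃ u : Y, IsSubgradientOn univ g y u := by
  obtain ⟨u, hu, -⟩ := exists_isSubgradientOn_of_isMinOn (X := ℝ) (D := univ) (f := fun _ => 0) hg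
    hgc (convexOn_const 0 convex_univ) (0 : ℝ →ₗ[ℝ] Y) y (a := 0) (mem_univ _) (by simp)
  exact ⟨u, by simpa using hu⟩

/-- For `ν = 0` the vector `u` must vanish and any subgradient of `g` serves. This lets zero weights
`θ'` and `ν = 0` be treated like positive ones. -/
lemma IsSubgradientOn.exists_of_smul [CompleteSpace Y] {g : Y → ℝ}
    (hg : ConvexOn ℝ univ g) (hgc : Continuous g) {ν : ℝ} (hν : 0 ≤ ν) {y u : Y}
    (h : IsSubgradientOn univ (fun y => ν * g y) y u) :
    ∃ w, IsSubgradientOn univ g y w ∧ u = ν • w := by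
  rcases hν.eq_or_lt with rfl | hν
  · obtain ⟨w, hw⟩ := exists_isSubgradientOn hg hgc y
    refine ⟨w, hw, ?_⟩
    have := h (y + u) (mem_univ _)
    rw [add_sub_cancel_left, real_inner_self_eq_norm_sq] at this
    rw [zero_smul, ← norm_eq_zero]
    exact pow_eq_zero_iff two_ne_zero |>.1 (le_antisymm (by linarith) (sq_nonneg _))
  · refine ⟨ν⁻¹ • u, fun z hz => ?_, by rw [smul_smul, mul_inv_cancel₀ hν.ne', one_smul]⟩
    have := h z hz
    rw [real_inner_smul_left]
    have h2 : ν * (g y + ν⁻¹ * inner ℝ u (z - y)) ≤ ν * g z := by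
      rw [mul_add, mul_inv_cancel_left₀ hν.ne']
      exact this
    exact le_of_mul_le_mul_left h2 hν

/-- Subgradients of a finite convex function are bounded on bounded sets. -/
lemma exists_norm_le_of_isSubgradientOn [FiniteDimensional ℝ Y] {g : Y → ℝ}
    (hg : ConvexOn ℝ univ g) (ρ : ℝ) :
    ∃ B : ℝ, 0 ≤ B ∧ ∀ y u : Y, ‖y‖ ≤ ρ → IsSubgradientOn univ g y u → ‖u‖ ≤ B := by
  obtain ⟨K, hK⟩ := (hg.locallyLipschitz.locallyLipschitzOn).exists_lipschitzOnWith_of_compact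
    (isCompact_closedBall (0 : Y) (ρ + 1))
  refine ⟨K, K.2, fun y u hy hu => ?_⟩
  rcases eq_or_ne u 0 with rfl | hu0
  · simp
  have hn : 0 < ‖u‖ := norm_pos_iff.2 hu0
  have hv : ‖(‖u‖⁻¹ • u : Y)‖ = 1 := by
    rw [norm_smul, norm_inv, norm_norm, inv_mul_cancel₀ hn.ne']
  -- A unit step in the direction of `u` raises `g` by at least `‖u‖`; the ball of radius `ρ + 1`
  -- contains that step.
  have h1 := hu (y + ‖u‖⁻¹ • u) (mem_univ _)
  rw [add_sub_cancel_left, real_inner_smul_right, real_inner_self_eq_norm_sq] at h1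
  have h2 := hK.dist_le_mul (y + ‖u‖⁻¹ • u)
    (by rw [mem_closedBall_zero_iff]; exact (norm_add_le _ _).trans (by rw [hv]; linarith)) y
    (by rw [mem_closedBall_zero_iff]; linarith)
  rw [dist_eq_norm, dist_eq_norm, add_sub_cancel_left, hv, mul_one, Real.norm_eq_abs] at h2
  have h3 := (le_abs_self _).trans h2
  have h4 : ‖u‖⁻¹ * ‖u‖ ^ 2 = ‖u‖ := by field_simp
  linarith

/-- A finite convex function is Lipschitz on bounded sets. -/
lemma ConvexOn.exists_lipschitz_of_norm_le [FiniteDimensional ℝ Y] {g : Y → ℝ}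
    (hg : ConvexOn ℝ univ g) (ρ : ℝ) :
    ∃ B : ℝ, 0 ≤ B ∧ ∀ y z : Y, ‖y‖ ≤ ρ → ‖z‖ ≤ ρ → g y - g z ≤ B * ‖y - z‖ := by
  obtain ⟨K, hK⟩ := (hg.locallyLipschitz.locallyLipschitzOn).exists_lipschitzOnWith_of_compact
    (isCompact_closedBall (0 : Y) ρ)
  refine ⟨K, K.2, fun y z hy hz => ?_⟩
  have h := hK.dist_le_mul y (by simpa using hy) z (by simpa using hz)
  rw [dist_eq_norm, dist_eq_norm, Real.norm_eq_abs] at h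
  exact (le_abs_self _).trans h

lemma mem_basicSubdiff_of_mem_regularSubdiff {f : E → EReal} {x v : E}
    (h : v ∈ regularSubdiff f x) : v ∈ basicSubdiff f x :=
  ⟨h.1, h.2.1, fun _ => x, fun _ => v, tendsto_const_nhds, tendsto_const_nhds, fun _ => h,
    tendsto_const_nhds⟩

lemma mem_basicSubdiff_of_forall_le {f : E → EReal} {x v : E} (hb : f x ≠ ⊥) (ht : f x ≠ ⊤)
    (h : ∀ y, f x + ((inner ℝ v (y - x) : ℝ) : EReal) ≤ f y) : v ∈ basicSubdiff f x := by
  refine mem_basicSubdiff_of_mem_regularSubdiff ⟨hb, ht, fun ε hε => Eventually.of_forall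
    fun y => le_trans ?_ (h y)⟩
  gcongr
  have : 0 ≤ ε * ‖y - x‖ := by positivity
  linarith

lemma IsSubgradientOn.mem_basicSubdiff {g : E → ℝ} {x v : E} (h : IsSubgradientOn univ g x v) :
    v ∈ basicSubdiff (fun y => (g y : EReal)) x := by
  refine mem_basicSubdiff_of_forall_le (EReal.coe_ne_bot _) (EReal.coe_ne_top _) fun y => ?_
  exact_mod_cast h y (mem_univ _)

lemma IsSubgradientOn.abs_le_one {t s : ℝ} (h : IsSubgradientOn univ (fun t : ℝ => |t|) t s) :
    |s| ≤ 1 := by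
  have h1 := h (t + 1) (mem_univ _)
  have h2 := h (t - 1) (mem_univ _)
  have e1 : t + 1 - t = (1 : ℝ) := by ring
  have e2 : t - 1 - t = (-1 : ℝ) := by ring
  simp only [e1, e2, Real.inner_apply] at h1 h2
  have h3 : |t + 1| ≤ |t| + 1 := by simpa using abs_add_le t 1
  have h4 : |t - 1| ≤ |t| + 1 := by simpa using abs_sub t 1
  rw [abs_le]
  constructor <;> linarith

end ConvexSubgradients

/-! ### The family `ℒ` and entrywise operations on matrices -/

section FamilyL

variable {θ : ℝ → ℝ} {a b : ℝ}

lemma MemFamilyL.hasDerivAt (hθ : MemFamilyL θ) (ha : 0 ≤ a) : HasDerivAt θ (deriv θ a) a := by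
  obtain ⟨⟨I, hI, -, hsub, -, hd, -⟩, -⟩ := hθ
  exact (hd.differentiableAt (hI.mem_nhds (hsub ha))).hasDerivAt

lemma MemFamilyL.le_tangent (hθ : MemFamilyL θ) (ha : 0 ≤ a) (hb : 0 ≤ b) :
    θ b ≤ θ a + deriv θ a * (b - a) := by
  have hd := hθ.hasDerivAt ha
  obtain ⟨⟨I, -, -, hsub, hc, -, -⟩, -⟩ := hθ
  rcases lt_trichotomy a b with h | rfl | h
  · have := hc.slope_le_of_hasDerivAt (hsub ha) (hsub hb) h hd
    rw [slope_def_field, div_le_iff₀ (by linarith)] at this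
    linarith
  · simp
  · have := hc.le_slope_of_hasDerivAt (hsub hb) (hsub ha) h hd
    rw [slope_def_field, le_div_iff₀ (by linarith)] at this
    linarith

lemma MemFamilyL.nonneg (hθ : MemFamilyL θ) (ha : 0 ≤ a) : 0 ≤ θ a := by
  have h1 := hθ.le_tangent ha le_rfl
  have h2 := mul_nonneg (hθ.2.1 a ha) ha
  rw [hθ.2.2] at h1
  linarith

/-- Adding the tangent inequalities at `a` and at `0` gives monotonicity of the derivative; the
consequence of interest is a bound on the weights that is uniform over all matrices. -/
lemma MemFamilyL.deriv_le (hθ : MemFamilyL θ) (ha : 0 ≤ a) : deriv θ a ≤ deriv θ 0 := by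
  have h1 := hθ.le_tangent ha le_rfl
  have h2 := hθ.le_tangent le_rfl ha
  rcases ha.eq_or_lt with rfl | ha
  · rfl
  · have : 0 ≤ (deriv θ 0 - deriv θ a) * a := by nlinarith
    have := nonneg_of_mul_nonneg_left this ha
    linarith

lemma MemFamilyL.continuousOn_deriv (hθ : MemFamilyL θ) : ContinuousOn (deriv θ) (Ici 0) := by
  obtain ⟨⟨I, -, -, hsub, -, -, hL⟩, -⟩ := hθ
  exact hL.continuousOn.mono hsub

lemma MemFamilyL.exists_lipschitz_deriv (hθ : MemFamilyL θ) (ρ : ℝ) :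
    ∃ L : ℝ, 0 ≤ L ∧ ∀ a b : ℝ, 0 ≤ a → 0 ≤ b → a ≤ ρ → b ≤ ρ →
      |deriv θ a - deriv θ b| ≤ L * |a - b| := by
  obtain ⟨⟨I, -, -, hsub, -, -, hL⟩, -⟩ := hθ
  obtain ⟨K, hK⟩ := (hL.mono (fun t (ht : t ∈ Icc 0 ρ) => hsub ht.1)).exists_lipschitzOnWith_of_compact
    isCompact_Icc
  exact ⟨K, K.2, fun a b ha hb ha' hb' => by
    simpa [Real.dist_eq] using hK.dist_le_mul a ⟨ha, ha'⟩ b ⟨hb, hb'⟩⟩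

end FamilyL

namespace FMat

variable {a b : ℕ}

/-- The entrywise product. -/
def hadamard (y s : FMat a b) : FMat a b := WithLp.toLp 2 fun ij => y ij * s ij

@[simp] lemma hadamard_apply (y s : FMat a b) (ij : Fin a × Fin b) :
    hadamard y s ij = y ij * s ij := rfl

@[simp] lemma abs_apply (z : FMat a b) (ij : Fin a × Fin b) : z.abs ij = |z ij| := rfl

@[simp] lemma gradVartheta_apply (θ : ℝ → ℝ) (z : FMat a b) (ij : Fin a × Fin b) :
    gradVartheta θ z ij = deriv θ (z ij) := rfl

lemma inner_eq_sum (y z : FMat a b) : inner ℝ y z = ∑ ij, y ij * z ij := by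
  simp [PiLp.inner_apply, mul_comm]

lemma norm_le_mul_norm {u v : FMat a b} {L : ℝ} (hL : 0 ≤ L) (h : ∀ ij, |u ij| ≤ L * |v ij|) :
    ‖u‖ ≤ L * ‖v‖ := by
  refine abs_le_of_sq_le_sq' ?_ (by positivity) |>.2
  rw [mul_pow, EuclideanSpace.real_norm_sq_eq, EuclideanSpace.real_norm_sq_eq, Finset.mul_sum]
  refine Finset.sum_le_sum fun ij _ => ?_
  rw [← sq_abs, ← sq_abs (v ij), ← mul_pow]
  have := h ij
  gcongr

lemma norm_le_of_forall_abs_le {u : FMat a b} {G : ℝ} (hG : 0 ≤ G) (h : ∀ ij, |u ij| ≤ G) :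
    ‖u‖ ≤ G * ‖(WithLp.toLp 2 fun _ => 1 : FMat a b)‖ :=
  norm_le_mul_norm hG fun ij => by simpa using h ij

lemma abs_apply_le_norm (z : FMat a b) (ij : Fin a × Fin b) : |z ij| ≤ ‖z‖ := by
  simpa using PiLp.norm_apply_le z ij

lemma norm_abs_sub_abs_le (y z : FMat a b) : ‖y.abs - z.abs‖ ≤ ‖y - z‖ := by
  have := norm_le_mul_norm (u := y.abs - z.abs) (v := y - z) zero_le_one fun ij => by
    simpa using abs_abs_sub_abs_le (y ij) (z ij)
  simpa using this

lemma continuous_abs : Continuous (FMat.abs : FMat a b → FMat a b) := by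
  refine (LipschitzWith.of_dist_le_mul (K := 1) fun y z => ?_).continuous
  simpa [dist_eq_norm] using norm_abs_sub_abs_le y z

lemma convexOn_inner_abs {y : FMat a b} (hy : ∀ ij, 0 ≤ y ij) :
    ConvexOn ℝ univ fun z : FMat a b => inner ℝ y z.abs := by
  refine ⟨convex_univ, fun z _ z' _ α β hα hβ _ => ?_⟩
  simp only [inner_eq_sum, abs_apply, PiLp.add_apply, PiLp.smul_apply, smul_eq_mul,
    Finset.mul_sum]
  rw [← Finset.sum_add_distrib]
  refine Finset.sum_le_sum fun ij _ => ?_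
  have h : |α * z ij + β * z' ij| ≤ α * |z ij| + β * |z' ij| := by
    refine (abs_add_le _ _).trans ?_
    rw [abs_mul, abs_mul, abs_of_nonneg hα, abs_of_nonneg hβ]
  nlinarith [mul_le_mul_of_nonneg_left h (hy ij)]

/-- The subgradients of the weighted sum `⟪y, |·|⟫` are entrywise. -/
lemma exists_hadamard_of_isSubgradientOn {y z u : FMat a b} (hy : ∀ ij, 0 ≤ y ij)
    (h : IsSubgradientOn univ (fun z : FMat a b => inner ℝ y z.abs) z u) :
    ∃ s : FMat a b, (∀ ij, IsSubgradientOn univ (fun t : ℝ => |t|) (z ij) (s ij)) ∧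
      u = hadamard y s := by
  have key : ∀ ij, ∃ s : ℝ, IsSubgradientOn univ (fun t : ℝ => |t|) (z ij) s ∧
      u ij = y ij * s := by
    intro ij
    refine IsSubgradientOn.exists_of_smul (Y := ℝ) (g := fun t : ℝ => |t|)
      (convexOn_norm (E := ℝ) convex_univ) _root_.continuous_abs (hy ij) ?_
    intro t _
    -- Only one entry is perturbed, so all other terms of the sum cancel.
    have h1 := h (z + EuclideanSpace.single ij (t - z ij)) (mem_univ _)
    simp only [add_sub_cancel_left, inner_eq_sum] at h1
    rw [← Finset.add_sum_erase _ _ (Finset.mem_univ ij),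
      ← Finset.add_sum_erase _ (fun kl => y kl *
        (z + EuclideanSpace.single ij (t - z ij)).abs kl) (Finset.mem_univ ij),
      ← Finset.add_sum_erase _ (fun kl => u kl *
        (EuclideanSpace.single ij (t - z ij) : FMat a b) kl) (Finset.mem_univ ij)] at h1
    have e1 : ∑ kl ∈ Finset.univ.erase ij,
        u kl * (EuclideanSpace.single ij (t - z ij) : FMat a b) kl = 0 :=
      Finset.sum_eq_zero fun kl hkl => by simp [Finset.ne_of_mem_erase hkl]
    have e2 : ∑ kl ∈ Finset.univ.erase ij,
        y kl * (z + EuclideanSpace.single ij (t - z ij)).abs kl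
        = ∑ kl ∈ Finset.univ.erase ij, y kl * z.abs kl :=
      Finset.sum_congr rfl fun kl hkl => by simp [Finset.ne_of_mem_erase hkl]
    rw [e1, e2] at h1
    simp at h1
    simp only [Real.inner_apply]
    linarith
  choose s hs using key
  exact ⟨WithLp.toLp 2 s, fun ij => (hs ij).1, by ext ij; exact (hs ij).2⟩

end FMat

section Vartheta

variable {θ : ℝ → ℝ} {a b : ℕ}

lemma MemFamilyL.gradVartheta_nonneg (hθ : MemFamilyL θ) (z : FMat a b) (ij : Fin a × Fin b) :
    0 ≤ gradVartheta θ z.abs ij := hθ.2.1 _ (abs_nonneg _)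

lemma MemFamilyL.vartheta_nonneg (hθ : MemFamilyL θ) (z : FMat a b) : 0 ≤ vartheta θ z.abs :=
  Finset.sum_nonneg fun _ _ => hθ.nonneg (abs_nonneg _)

lemma MemFamilyL.vartheta_le_tangent (hθ : MemFamilyL θ) (y z : FMat a b) :
    vartheta θ z.abs ≤ vartheta θ y.abs + inner ℝ (gradVartheta θ y.abs) (z.abs - y.abs) := by
  rw [FMat.inner_eq_sum, vartheta, vartheta, ← Finset.sum_add_distrib]
  refine Finset.sum_le_sum fun ij _ => ?_
  simpa using hθ.le_tangent (abs_nonneg (y ij)) (abs_nonneg (z ij))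

lemma MemFamilyL.exists_norm_gradVartheta_le (hθ : MemFamilyL θ) (a b : ℕ) :
    ∃ G : ℝ, 0 ≤ G ∧ ∀ (z s : FMat a b), (∀ ij, |s ij| ≤ 1) →
      ‖FMat.hadamard (gradVartheta θ z.abs) s‖ ≤ G := by
  have h0 : 0 ≤ deriv θ 0 := hθ.2.1 0 le_rfl
  refine ⟨_, mul_nonneg h0 (norm_nonneg _), fun z s hs =>
    FMat.norm_le_of_forall_abs_le h0 fun ij => ?_⟩
  rw [FMat.hadamard_apply, abs_mul, abs_of_nonneg (hθ.gradVartheta_nonneg z ij)]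
  calc _ ≤ deriv θ 0 * 1 := by
        gcongr
        · exact hθ.deriv_le (abs_nonneg _)
        · exact hs ij
    _ = _ := mul_one _

lemma MemFamilyL.exists_lipschitz_gradVartheta (hθ : MemFamilyL θ) (a b : ℕ) (ρ : ℝ) :
    ∃ L : ℝ, 0 ≤ L ∧ ∀ (y z s : FMat a b), ‖y‖ ≤ ρ → ‖z‖ ≤ ρ → (∀ ij, |s ij| ≤ 1) →
      ‖FMat.hadamard (gradVartheta θ y.abs) s - FMat.hadamard (gradVartheta θ z.abs) s‖
        ≤ L * ‖y - z‖ := by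
  obtain ⟨L, hL, h⟩ := hθ.exists_lipschitz_deriv ρ
  refine ⟨L, hL, fun y z s hy hz hs => FMat.norm_le_mul_norm hL fun ij => ?_⟩
  have h1 := h _ _ (abs_nonneg (y ij)) (abs_nonneg (z ij)) ((y.abs_apply_le_norm ij).trans hy)
    ((z.abs_apply_le_norm ij).trans hz)
  simp only [PiLp.sub_apply, FMat.hadamard_apply, FMat.gradVartheta_apply, FMat.abs_apply]
  rw [← sub_mul, abs_mul]
  calc _ ≤ L * |(|y ij| - |z ij|)| * 1 := by
        gcongr
        exact hs ij
    _ ≤ L * |y ij - z ij| := by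
        rw [mul_one]
        exact mul_le_mul_of_nonneg_left (abs_abs_sub_abs_le (y ij) (z ij)) hL

lemma MemFamilyL.continuous_vartheta (hθ : MemFamilyL θ) :
    Continuous fun z : FMat a b => vartheta θ z.abs := by
  unfold vartheta
  refine continuous_finsetSum _ fun ij _ => ?_
  rw [continuous_iff_continuousAt]
  intro z
  have h1 : ContinuousAt θ |z ij| := (hθ.hasDerivAt (abs_nonneg _)).continuousAt
  have h2 : ContinuousAt (fun z : FMat a b => |z ij|) z := by fun_prop
  exact ContinuousAt.comp (f := fun z : FMat a b => |z ij|) (g := θ) h1 h2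

lemma MemFamilyL.continuous_gradVartheta (hθ : MemFamilyL θ) :
    Continuous fun z : FMat a b => gradVartheta θ z.abs := by
  refine (PiLp.continuous_toLp 2 _).comp (continuous_pi fun ij => ?_)
  have h2 : Continuous (fun z : FMat a b => |z ij|) := by fun_prop
  exact hθ.continuousOn_deriv.comp_continuous h2 fun z => mem_Ici.2 (abs_nonneg (z ij))

end Vartheta

namespace CompositeModel

variable {X : Type*} [NormedAddCommGroup X] [InnerProductSpace ℝ X] {m n p q : ℕ}

/-! ### Real-valued versions on the domain of `h` -/

section RealVersions

/-- The real-valued version of `h`. -/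
noncomputable def hReal (M : CompositeModel X m n p q) (x : X) : ℝ := (M.h x).toReal

/-- The real-valued version of the objective function. -/
noncomputable def objReal (M : CompositeModel X m n p q) (x : X) : ℝ :=
  vartheta M.θ (M.F x).abs + M.ν * M.ψ (M.T x) + M.lam * M.hReal x

/-- The real-valued version of the surrogate. -/
noncomputable def surrogateReal (M : CompositeModel X m n p q) (z : X) (Q : X →ₗ[ℝ] X) (x : X) :
    ℝ :=
  inner ℝ (gradVartheta M.θ (M.F z).abs) (M.linF x z).abs + M.ν * M.ψ (M.linT x z)
    + 1 / 2 * inner ℝ (x - z) (Q (x - z)) + M.surrogateConst z + M.lam * M.hReal x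

/-- The real-valued version of the potential. -/
noncomputable def potentialReal (M : CompositeModel X m n p q) (γ : ℝ) (w : Triple X) : ℝ :=
  vartheta M.θ (M.linF w.fst w.snd.fst).abs + M.ν * M.ψ (M.linT w.fst w.snd.fst)
    + γ / 2 * ‖w.fst - w.snd.fst‖ ^ 2 + w.snd.snd ^ 2 + M.lam * M.hReal w.fst

variable {M : CompositeModel X m n p q}

lemma BasicAssumption.h_ne_bot (hM : M.BasicAssumption) (x : X) : M.h x ≠ ⊥ := by
  obtain ⟨c, hc⟩ := hM.h_bddBelow
  exact ne_bot_of_le_ne_bot (EReal.coe_ne_bot c) (hc x)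

lemma BasicAssumption.coe_hReal (hM : M.BasicAssumption) {x : X} (hx : x ∈ effDom M.h) :
    (M.hReal x : EReal) = M.h x :=
  EReal.coe_toReal (ne_of_lt hx) (hM.h_ne_bot x)

lemma h_eq_top {x : X} (hx : x ∉ effDom M.h) : M.h x = ⊤ := not_lt_top_iff.1 hx

lemma coe_add_lam_mul_top (hlam : 0 < M.lam) (c : ℝ) : (c : EReal) + (M.lam : EReal) * ⊤ = ⊤ := by
  rw [EReal.coe_mul_top_of_pos hlam, EReal.coe_add_top]

lemma BasicAssumption.coe_objReal (hM : M.BasicAssumption) {x : X} (hx : x ∈ effDom M.h) :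
    (M.objReal x : EReal) = M.obj x := by
  rw [obj, ← hM.coe_hReal hx, objReal]; norm_cast

lemma BasicAssumption.coe_surrogateReal (hM : M.BasicAssumption) {x : X} (hx : x ∈ effDom M.h)
    (z : X) (Q : X →ₗ[ℝ] X) : (M.surrogateReal z Q x : EReal) = M.surrogate z Q x := by
  rw [surrogate, ← hM.coe_hReal hx, surrogateReal]; norm_cast

lemma BasicAssumption.coe_potentialReal (hM : M.BasicAssumption) {w : Triple X}
    (hw : w.fst ∈ effDom M.h) (γ : ℝ) : (M.potentialReal γ w : EReal) = M.potential γ w := by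
  rw [potential, ← hM.coe_hReal hw, potentialReal]; norm_cast

lemma surrogate_eq_top (hlam : 0 < M.lam) {x : X} (hx : x ∉ effDom M.h) (z : X) (Q : X →ₗ[ℝ] X) :
    M.surrogate z Q x = ⊤ := by
  rw [surrogate, h_eq_top hx, coe_add_lam_mul_top hlam]

lemma potential_eq_top (hlam : 0 < M.lam) {w : Triple X} (hw : w.fst ∉ effDom M.h) (γ : ℝ) :
    M.potential γ w = ⊤ := by
  rw [potential, h_eq_top hw, coe_add_lam_mul_top hlam]

lemma mem_effDom_of_surrogate_lt_top (hlam : 0 < M.lam) {x z : X} {Q : X →ₗ[ℝ] X}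
    (h : M.surrogate z Q x < ⊤) : x ∈ effDom M.h := by
  by_contra hx
  exact h.ne (surrogate_eq_top hlam hx z Q)

lemma BasicAssumption.exists_le_hReal (hM : M.BasicAssumption) :
    ∃ c : ℝ, ∀ x ∈ effDom M.h, c ≤ M.hReal x := by
  obtain ⟨c, hc⟩ := hM.h_bddBelow
  refine ⟨c, fun x hx => ?_⟩
  have := hc x
  rw [← hM.coe_hReal hx] at this
  exact_mod_cast this

lemma BasicAssumption.exists_le_ψ (hM : M.BasicAssumption) : ∃ c : ℝ, ∀ y, c ≤ M.ψ y := by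
  obtain ⟨c, hc⟩ := hM.ψ_bddBelow
  exact ⟨c, fun y => hc ⟨y, rfl⟩⟩

lemma BasicAssumption.convexOn_hReal (hM : M.BasicAssumption) :
    ConvexOn ℝ (effDom M.h) M.hReal := by
  have key : ∀ x ∈ effDom M.h, ∀ y ∈ effDom M.h, ∀ α β : ℝ, 0 ≤ α → 0 ≤ β → α + β = 1 →
      M.h (α • x + β • y) ≤ ((α * M.hReal x + β * M.hReal y : ℝ) : EReal) := by
    intro x hx y hy α β hα hβ hαβ
    exact hM.h_convex (x := (x, M.hReal x)) (y := (y, M.hReal y)) (hM.coe_hReal hx).ge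
      (hM.coe_hReal hy).ge hα hβ hαβ
  have hmem : ∀ x ∈ effDom M.h, ∀ y ∈ effDom M.h, ∀ α β : ℝ, 0 ≤ α → 0 ≤ β → α + β = 1 →
      α • x + β • y ∈ effDom M.h := fun x hx y hy α β hα hβ hαβ =>
    (key x hx y hy α β hα hβ hαβ).trans_lt (EReal.coe_lt_top _)
  refine ⟨fun x hx y hy α β hα hβ hαβ => hmem x hx y hy α β hα hβ hαβ,
    fun x hx y hy α β hα hβ hαβ => ?_⟩
  have h1 := key x hx y hy α β hα hβ hαβ
  rw [← hM.coe_hReal (hmem x hx y hy α β hα hβ hαβ)] at h1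
  exact_mod_cast h1

lemma BasicAssumption.continuousOn_hReal (hM : M.BasicAssumption) :
    ContinuousOn M.hReal (effDom M.h) := hM.h_strictCont.continuousOn

lemma BasicAssumption.continuous_ψ (hM : M.BasicAssumption) : Continuous M.ψ :=
  hM.ψ_convex.locallyLipschitz.continuous

lemma linF_self (x : X) : M.linF x x = M.F x := by simp [linF]

lemma linT_self (x : X) : M.linT x x = M.T x := by simp [linT]

lemma surrogateReal_self (x : X) (Q : X →ₗ[ℝ] X) : M.surrogateReal x Q x = M.objReal x := by
  simp [surrogateReal, objReal, linF_self, linT_self, surrogateConst]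
  ring

/-- The compact sets that contain all the points generated by the method. -/
lemma BasicAssumption.isCompact_sublevel [FiniteDimensional ℝ X] (hM : M.BasicAssumption)
    (c ρ : ℝ) : IsCompact ({x | M.h x ≤ (c : EReal)} ∩ Metric.closedBall (0 : X) ρ) :=
  (isCompact_closedBall 0 ρ).inter_left (hM.h_lsc.isClosed_preimage (c : EReal))

lemma BasicAssumption.convex_sublevel (hM : M.BasicAssumption)
    (c ρ : ℝ) : Convex ℝ ({x | M.h x ≤ (c : EReal)} ∩ Metric.closedBall (0 : X) ρ) := by
  refine Convex.inter (fun x hx y hy α β hα hβ hαβ => ?_) (convex_closedBall 0 ρ)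
  have := hM.h_convex (x := (x, c)) (y := (y, c)) hx hy hα hβ hαβ
  simpa [← add_mul, hαβ] using this

lemma sublevel_subset_effDom (c ρ : ℝ) :
    {x | M.h x ≤ (c : EReal)} ∩ Metric.closedBall (0 : X) ρ ⊆ effDom M.h :=
  fun _ hx => lt_of_le_of_lt hx.1 (EReal.coe_lt_top c)

end RealVersions

/-! ### Optimality of the subproblems -/

section Optimality

lemma _root_.ConvexOn.comp_const_add_linearMap {Y : Type*} [NormedAddCommGroup Y] [NormedSpace ℝ Y]
    {g : Y → ℝ} (hg : ConvexOn ℝ univ g) (A : X →ₗ[ℝ] Y) (b : Y) :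
    ConvexOn ℝ univ fun x => g (b + A x) := by
  have h := (hg.translate_right b).comp_linearMap A
  simpa [Function.comp_def] using h

lemma _root_.convexOn_quadratic {Q : X →ₗ[ℝ] X} (hQ : ∀ u, 0 ≤ inner ℝ u (Q u)) (z : X) :
    ConvexOn ℝ univ fun x => (1 / 2 : ℝ) * inner ℝ (x - z) (Q (x - z)) := by
  refine ⟨convex_univ, fun x _ y _ α β hα hβ hαβ => ?_⟩
  have e : α • x + β • y - z = α • (x - z) + β • (y - z) := by
    rw [smul_sub, smul_sub, sub_add_sub_comm, ← add_smul, hαβ, one_smul]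
  have h := hQ ((x - z) - (y - z))
  simp only [e]
  generalize x - z = a at *
  generalize y - z = b at *
  have hβ' : β = 1 - α := by linarith
  simp only [map_add, map_sub, map_smul, inner_add_left, inner_add_right, inner_sub_left,
    inner_sub_right, real_inner_smul_left, real_inner_smul_right, smul_eq_mul] at h ⊢
  have : 0 ≤ α * β * (inner ℝ a (Q a) - inner ℝ b (Q a) - (inner ℝ a (Q b) - inner ℝ b (Q b))) := by
    positivity
  subst hβ'
  nlinarith

/-- If the defect `d` were nonzero, a short step along it would violate the subgradient inequality:
the linear gain `t * ‖d‖ ^ 2` exceeds the quadratic cost, at most half of it for the chosen `t`. -/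
lemma _root_.eq_of_isSubgradientOn_quadratic {Q : X →ₗ[ℝ] X} (hQs : Q.IsSymmetric)
    (hQ : ∀ u, 0 ≤ inner ℝ u (Q u)) {z a u : X}
    (h : IsSubgradientOn univ (fun x => (1 / 2 : ℝ) * inner ℝ (x - z) (Q (x - z))) a u) :
    u = Q (a - z) := by
  set d := u - Q (a - z) with hd
  by_contra hne
  have hd0 : 0 < ‖d‖ ^ 2 := by
    have : d ≠ 0 := sub_ne_zero.2 hne
    positivity
  set κ := inner ℝ d (Q d)
  have hκ : 0 ≤ κ := hQ d
  set t := ‖d‖ ^ 2 / (κ + 1) with ht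
  have ht0 : 0 < t := by positivity
  have h1 := h (a + t • d) (mem_univ _)
  have e : a + t • d - z = (a - z) + t • d := by abel
  simp only [e, add_sub_cancel_left, map_add, map_smul, inner_add_left, inner_add_right,
    real_inner_smul_left, real_inner_smul_right] at h1
  have h2 : inner ℝ (a - z) (Q d) = inner ℝ d (Q (a - z)) := by
    rw [← hQs, real_inner_comm]
  have h3 : inner ℝ u d - inner ℝ d (Q (a - z)) = ‖d‖ ^ 2 := by
    rw [real_inner_comm (Q (a - z)) d, ← inner_sub_left, ← hd, real_inner_self_eq_norm_sq]
  rw [h2] at h1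
  have h4 : t * ‖d‖ ^ 2 ≤ t * (t / 2 * κ) := by
    rw [← h3]
    change _ ≤ t * (t / 2 * inner ℝ d (Q d))
    linarith
  have h5 := le_of_mul_le_mul_left h4 ht0
  have h6 : t * κ ≤ ‖d‖ ^ 2 := by
    rw [ht, div_mul_eq_mul_div, div_le_iff₀ (by positivity)]
    nlinarith
  linarith

variable {M : CompositeModel X m n p q} [FiniteDimensional ℝ X]

/-- The optimality conditions of the subproblem at its minimizer `a`. -/
theorem BasicAssumption.exists_multipliers (hM : M.BasicAssumption) (hν : 0 ≤ M.ν)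
    (hlam : 0 < M.lam) {z a : X} {Q : X →ₗ[ℝ] X} (hQs : Q.IsSymmetric)
    (hQ : ∀ u, 0 ≤ inner ℝ u (Q u)) (ha : a ∈ effDom M.h)
    (hmin : ∀ x ∈ effDom M.h, M.surrogateReal z Q a ≤ M.surrogateReal z Q x) :
    ∃ (s : FMat m n) (w : FMat p q) (η : X),
      (∀ ij, IsSubgradientOn univ (fun t : ℝ => |t|) (M.linF a z ij) (s ij)) ∧
      IsSubgradientOn univ M.ψ (M.linT a z) w ∧
      IsSubgradientOn (effDom M.h) M.hReal a η ∧
      ∀ x, inner ℝ (FMat.hadamard (gradVartheta M.θ (M.F z).abs) s) (fderiv ℝ M.F z x)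
        + M.ν * inner ℝ w (fderiv ℝ M.T z x) + M.lam * inner ℝ η x
        + inner ℝ (Q (a - z)) x = 0 := by
  set D := effDom M.h
  set y := gradVartheta M.θ (M.F z).abs with hy
  set A : X →ₗ[ℝ] FMat m n := (fderiv ℝ M.F z).toLinearMap with hA
  set B : X →ₗ[ℝ] FMat p q := (fderiv ℝ M.T z).toLinearMap with hB
  set b := M.F z - A z with hb
  set c := M.T z - B z with hc
  have hlF : ∀ x, M.linF x z = b + A x := fun x => by
    simp only [linF, hb, hA, ContinuousLinearMap.coe_coe, map_sub]; abel
  have hlT : ∀ x, M.linT x z = c + B x := fun x => by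
    simp only [linT, hc, hB, ContinuousLinearMap.coe_coe, map_sub]; abel
  have hy0 : ∀ ij, 0 ≤ y ij := fun ij => hM.θ_mem.gradVartheta_nonneg _ _
  have hD := hM.convexOn_hReal.1
  have cψ : ConvexOn ℝ univ fun y => M.ν * M.ψ y := hM.ψ_convex.smul hν
  have cψ' := (cψ.comp_const_add_linearMap B c).subset (subset_univ D) hD
  have cq := (convexOn_quadratic hQ z).subset (subset_univ D) hD
  have ch : ConvexOn ℝ D fun x => M.lam * M.hReal x := hM.convexOn_hReal.smul hlam.le
  have clin : ∀ {Y : Type} [NormedAddCommGroup Y] [InnerProductSpace ℝ Y] (u : Y)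
      (L : X →ₗ[ℝ] Y), ConvexOn ℝ D fun x => inner ℝ u (L x) := fun u L =>
    (((innerₛₗ ℝ u).comp L).convexOn hD)
  -- The summands are peeled off one at a time: the weighted absolute value, then `ν ψ`, then the
  -- quadratic. Each is replaced by a linear term, until only `lam * h` is left nonlinear.
  obtain ⟨u1, hu1, hm1⟩ := exists_isSubgradientOn_of_isMinOn (FMat.convexOn_inner_abs hy0)
    (continuous_const.inner FMat.continuous_abs) ((cψ'.add cq).add ch) A b ha (fun x hx => by
      have := hmin x hx
      simp only [surrogateReal, hlF, hlT] at this
      simp only [Pi.add_apply]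
      linarith)
  obtain ⟨s, hs, rfl⟩ := FMat.exists_hadamard_of_isSubgradientOn hy0 hu1
  set u1 := FMat.hadamard y s
  obtain ⟨u2, hu2, hm2⟩ := exists_isSubgradientOn_of_isMinOn cψ
    (continuous_const.mul hM.continuous_ψ) (((clin u1 A).add cq).add ch) B c ha (fun x hx => by
      have := hm1 x hx
      simp only [Pi.add_apply] at this ⊢
      linarith)
  obtain ⟨w, hw, rfl⟩ := hu2.exists_of_smul hM.ψ_convex hM.continuous_ψ hν
  have hqc : Continuous fun x => (1 / 2 : ℝ) * inner ℝ (x - z) (Q (x - z)) := by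
    have := Q.continuous_of_finiteDimensional
    fun_prop
  obtain ⟨u3, hu3, hm3⟩ := exists_isSubgradientOn_of_isMinOn (convexOn_quadratic hQ z) hqc
    (((clin u1 A).add (clin (M.ν • w) B)).add ch) LinearMap.id 0 ha (fun x hx => by
      have := hm2 x hx
      simp only [Pi.add_apply, LinearMap.id_apply, zero_add] at this ⊢
      linarith)
  simp only [LinearMap.id_apply, zero_add] at hu3 hm3
  have hu3' := eq_of_isSubgradientOn_quadratic hQs hQ hu3
  -- Chosen so that the multiplier identity holds by construction; the last minimality statement
  -- then says that `η` is a subgradient of `h`.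
  set η : X := -(M.lam⁻¹ • (LinearMap.adjoint A u1 + LinearMap.adjoint B (M.ν • w) + u3)) with hη
  have hηx : ∀ x, M.lam * inner ℝ η x
      = -(inner ℝ u1 (A x) + inner ℝ (M.ν • w) (B x) + inner ℝ u3 x) := fun x => by
    rw [hη, inner_neg_left, real_inner_smul_left, inner_add_left, inner_add_left,
      LinearMap.adjoint_inner_left, LinearMap.adjoint_inner_left, mul_neg,
      mul_inv_cancel_left₀ hlam.ne']
  refine ⟨s, w, η, fun ij => ?_, ?_, fun x hx => ?_, fun x => ?_⟩
  · rw [hlF]; exact hs ij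
  · rw [hlT]; exact hw
  · have h1 := hm3 x hx
    simp only [Pi.add_apply] at h1
    have h2 := hηx x
    have h3 := hηx a
    have : M.lam * (M.hReal a + inner ℝ η (x - a)) ≤ M.lam * M.hReal x := by
      rw [inner_sub_right]
      linarith
    exact le_of_mul_le_mul_left this hlam
  · have := hηx x
    rw [real_inner_smul_left] at this
    rw [← hu3']
    change inner ℝ u1 (A x) + M.ν * inner ℝ w (B x) + _ + _ = 0
    linarith

/-- The quadratic growth of the surrogate at its minimizer. -/
theorem BasicAssumption.surrogateReal_growth (hM : M.BasicAssumption) (hν : 0 ≤ M.ν)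
    (hlam : 0 < M.lam) {z a : X} {Q : X →ₗ[ℝ] X} (hQs : Q.IsSymmetric)
    (hQ : ∀ u, 0 ≤ inner ℝ u (Q u)) (ha : a ∈ effDom M.h)
    (hmin : ∀ x ∈ effDom M.h, M.surrogateReal z Q a ≤ M.surrogateReal z Q x)
    {x : X} (hx : x ∈ effDom M.h) :
    M.surrogateReal z Q a + 1 / 2 * inner ℝ (x - a) (Q (x - a)) ≤ M.surrogateReal z Q x := by
  -- In the sum of the three subgradient inequalities and the exact expansion of the quadratic, the
  -- linear terms cancel by `h0`, leaving the quadratic term around `a`.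
  obtain ⟨s, w, η, hs, hw, hη, h0⟩ := hM.exists_multipliers hν hlam hQs hQ ha hmin
  have h1 : inner ℝ (gradVartheta M.θ (M.F z).abs) (M.linF a z).abs
      + inner ℝ (FMat.hadamard (gradVartheta M.θ (M.F z).abs) s) (M.linF x z - M.linF a z)
      ≤ inner ℝ (gradVartheta M.θ (M.F z).abs) (M.linF x z).abs := by
    simp only [FMat.inner_eq_sum, ← Finset.sum_add_distrib]
    refine Finset.sum_le_sum fun ij _ => ?_
    have := mul_le_mul_of_nonneg_left (hs ij (M.linF x z ij) (mem_univ _))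
      (hM.θ_mem.gradVartheta_nonneg (M.F z) ij)
    simp only [Real.inner_apply, FMat.hadamard_apply, PiLp.sub_apply, FMat.abs_apply] at this ⊢
    linarith
  have h2 := mul_le_mul_of_nonneg_left (hw (M.linT x z) (mem_univ _)) hν
  have h3 := mul_le_mul_of_nonneg_left (hη x hx) hlam.le
  have h4 := h0 (x - a)
  have e1 : M.linF x z - M.linF a z = fderiv ℝ M.F z (x - a) := by
    simp only [linF, map_sub]; abel
  have e2 : M.linT x z - M.linT a z = fderiv ℝ M.T z (x - a) := by
    simp only [linT, map_sub]; abel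
  have e3 : x - z = (a - z) + (x - a) := by abel
  rw [e1] at h1
  rw [e2] at h2
  have h5 : inner ℝ (x - z) (Q (x - z)) = inner ℝ (a - z) (Q (a - z))
      + 2 * inner ℝ (Q (a - z)) (x - a) + inner ℝ (x - a) (Q (x - a)) := by
    rw [e3]
    generalize a - z = d
    generalize x - a = f
    rw [map_add, inner_add_left, inner_add_right, inner_add_right, ← hQs d f,
      real_inner_comm (Q d) f]
    ring
  simp only [surrogateReal, h5]
  linarith

end Optimality

end CompositeModel

/-! ### Linearization errors and majorization on compact convex sets. -/

/-- Uniform bounds for a twice continuously differentiable map and its linearizations on a compact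
convex set. -/
lemma ContDiffOn.exists_linearization_bounds {X V : Type*} [NormedAddCommGroup X]
    [NormedSpace ℝ X] [NormedAddCommGroup V] [NormedSpace ℝ V] {G : X → V} {O K : Set X}
    (hG : ContDiffOn ℝ 2 G O) (hO : IsOpen O) (hK : IsCompact K) (hKc : Convex ℝ K)
    (hKO : K ⊆ O) :
    ∃ B : ℝ, 0 ≤ B ∧ ∀ z ∈ K, ‖fderiv ℝ G z‖ ≤ B ∧ ‖fderiv ℝ (fderiv ℝ G) z‖ ≤ B ∧
      ∀ y ∈ K, ‖G z + fderiv ℝ G z (y - z)‖ ≤ B ∧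
        ‖G y - (G z + fderiv ℝ G z (y - z))‖ ≤ B * ‖y - z‖ ^ 2 := by
  have hG1 : ContDiffOn ℝ 1 (fderiv ℝ G) O := hG.fderiv_of_isOpen hO (by norm_num)
  have hG2 : ContDiffOn ℝ 0 (fderiv ℝ (fderiv ℝ G)) O := hG1.fderiv_of_isOpen hO (by norm_num)
  obtain ⟨B0, h0⟩ := hK.exists_bound_of_continuousOn (hG.continuousOn.mono hKO)
  obtain ⟨B1, h1⟩ := hK.exists_bound_of_continuousOn (hG1.continuousOn.mono hKO)
  obtain ⟨B2, h2⟩ := hK.exists_bound_of_continuousOn (f := fderiv ℝ (fderiv ℝ G))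
    (hG2.continuousOn.mono hKO)
  obtain ⟨B3, h3⟩ := hK.isBounded.exists_norm_le
  have hlip : ∀ y ∈ K, ∀ z ∈ K, ‖fderiv ℝ G y - fderiv ℝ G z‖ ≤ B2 * ‖y - z‖ := fun y hy z hz =>
    hKc.norm_image_sub_le_of_norm_fderiv_le (fun x hx =>
      (hG1.differentiableOn (by norm_num)).differentiableAt (hO.mem_nhds (hKO hx))) h2 hz hy
  refine ⟨max (max |B1| |B2|) (|B0| + |B1| * (|B3| + |B3|)), by positivity, fun z hz =>
    ⟨(h1 z hz).trans ?_, (h2 z hz).trans ?_, fun y hy => ⟨?_, ?_⟩⟩⟩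
  · exact (le_abs_self _).trans ((le_max_left _ _).trans (le_max_left _ _))
  · exact (le_abs_self _).trans ((le_max_right _ _).trans (le_max_left _ _))
  · refine le_trans ?_ (le_max_right _ _)
    refine (norm_add_le _ _).trans (add_le_add ((h0 z hz).trans (le_abs_self _)) ?_)
    refine (ContinuousLinearMap.le_opNorm _ _).trans (mul_le_mul ((h1 z hz).trans (le_abs_self _))
      ((norm_sub_le _ _).trans (add_le_add ((h3 y hy).trans (le_abs_self _))
        ((h3 z hz).trans (le_abs_self _)))) (norm_nonneg _) (abs_nonneg _))
  -- Mean value inequality for `G` minus its linearization: along the segment the derivative differs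
  -- from that at `z` by at most `|B2| * ‖y - z‖`.
  · have hseg : segment ℝ z y ⊆ K := hKc.segment_subset hz hy
    have hb : ∀ x ∈ segment ℝ z y, ‖fderiv ℝ G x - fderiv ℝ G z‖ ≤ |B2| * ‖y - z‖ := by
      intro x hx
      refine (hlip x (hseg hx) z hz).trans ?_
      gcongr
      · exact le_abs_self _
      · obtain ⟨t, ht, rfl⟩ := (segment_eq_image' ℝ z y ▸ hx)
        simp only [add_sub_cancel_left, norm_smul, Real.norm_eq_abs, abs_of_nonneg ht.1]
        exact mul_le_of_le_one_left (norm_nonneg _) ht.2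
    have := (convex_segment z y).norm_image_sub_le_of_norm_fderiv_le' (fun x hx =>
      (hG.differentiableOn (by norm_num)).differentiableAt (hO.mem_nhds (hKO (hseg hx)))) hb
      (left_mem_segment ℝ z y) (right_mem_segment ℝ z y)
    rw [← sub_sub]
    refine this.trans ?_
    rw [mul_assoc, ← sq]
    gcongr
    exact (le_max_right _ _).trans (le_max_left _ _)

namespace CompositeModel

variable {X : Type*} [NormedAddCommGroup X] [InnerProductSpace ℝ X] {m n p q : ℕ}
  {M : CompositeModel X m n p q}

/-- This is the tangent inequality at `|F z|` evaluated at the zero matrix, where `ϑ` vanishes. -/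
lemma BasicAssumption.surrogateConst_nonneg (hM : M.BasicAssumption) (z : X) :
    0 ≤ M.surrogateConst z := by
  have h := hM.θ_mem.vartheta_le_tangent (M.F z) 0
  have h0 : (FMat.abs (0 : FMat m n)) = 0 := by ext; simp
  have h1 : vartheta M.θ (0 : FMat m n) = 0 := by simp [vartheta, hM.θ_mem.2.2]
  rw [h0, h1, zero_sub, inner_neg_right] at h
  rw [surrogateConst]
  linarith

lemma BasicAssumption.inner_gradVartheta_abs_nonneg (hM : M.BasicAssumption) (y z : FMat m n) :
    0 ≤ inner ℝ (gradVartheta M.θ y.abs) z.abs := by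
  rw [FMat.inner_eq_sum]
  exact Finset.sum_nonneg fun ij _ =>
    mul_nonneg (hM.θ_mem.gradVartheta_nonneg y ij) (abs_nonneg _)

lemma BasicAssumption.exists_norm_gradVartheta_le (hM : M.BasicAssumption) :
    ∃ G : ℝ, 0 ≤ G ∧ ∀ z : FMat m n, ‖gradVartheta M.θ z.abs‖ ≤ G := by
  obtain ⟨G, hG, h⟩ := hM.θ_mem.exists_norm_gradVartheta_le m n
  refine ⟨G, hG, fun z => ?_⟩
  convert h z (WithLp.toLp 2 fun _ => 1) (by simp) using 2
  ext ij
  simp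

/-- The surrogate is a majorant up to a quadratic error on compact convex sets. -/
lemma BasicAssumption.exists_majorization (hM : M.BasicAssumption) (hν : 0 ≤ M.ν)
    (hF : ContDiffOn ℝ 2 M.F M.O) (hT : ContDiffOn ℝ 2 M.T M.O) {K : Set X}
    (hK : IsCompact K) (hKc : Convex ℝ K) (hKD : K ⊆ effDom M.h) :
    ∃ C : ℝ, 0 ≤ C ∧ ∀ y ∈ K, ∀ z ∈ K, ∀ Q : X →ₗ[ℝ] X,
      M.objReal y + 1 / 2 * inner ℝ (y - z) (Q (y - z))
        ≤ M.surrogateReal z Q y + C * ‖y - z‖ ^ 2 := by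
  obtain ⟨B, hB, hFB⟩ := hF.exists_linearization_bounds hM.O_open hK hKc (hKD.trans hM.dom_subset)
  obtain ⟨B', hB', hTB⟩ := hT.exists_linearization_bounds hM.O_open hK hKc
    (hKD.trans hM.dom_subset)
  obtain ⟨G, hG, hgrad⟩ := hM.exists_norm_gradVartheta_le
  obtain ⟨L, hL, hψ⟩ := hM.ψ_convex.exists_lipschitz_of_norm_le B'
  refine ⟨G * B + M.ν * (L * B'), by positivity, fun y hy z hz Q => ?_⟩
  -- Linearizing `ϑ` costs nothing, by concavity; only the linearization errors of `F` and `T`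
  -- remain.
  have h1 := hM.θ_mem.vartheta_le_tangent (M.F z) (M.F y)
  have h2 : inner ℝ (gradVartheta M.θ (M.F z).abs) ((M.F y).abs - (M.linF y z).abs)
      ≤ G * (B * ‖y - z‖ ^ 2) :=
    (real_inner_le_norm _ _).trans (mul_le_mul (hgrad _)
      ((FMat.norm_abs_sub_abs_le _ _).trans ((hFB z hz).2.2 y hy).2) (norm_nonneg _) hG)
  have h3 : M.ψ (M.T y) - M.ψ (M.linT y z) ≤ L * (B' * ‖y - z‖ ^ 2) := by
    refine (hψ _ _ ?_ ((hTB z hz).2.2 y hy).1).trans ?_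
    · simpa using ((hTB y hy).2.2 y hy).1
    · exact mul_le_mul_of_nonneg_left ((hTB z hz).2.2 y hy).2 hL
  have h4 := mul_le_mul_of_nonneg_left h3 hν
  rw [inner_sub_right] at h1 h2
  simp only [objReal, surrogateReal, surrogateConst]
  linarith

/-! ### Descent, compactness and bounded proximal parameters along a run. -/

namespace IPMMRun

variable (R : M.IPMMRun)

lemma γlo_le : ∀ k, ∀ j ≤ R.last k, R.γlo ≤ R.γ k j := by
  intro k j
  induction j with
  | zero => exact fun _ => (R.γ_zero_mem k).1
  | succ j ih =>
    intro hj
    rw [(R.rejected k j hj).2]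
    have h1 := ih (by omega)
    have := R.γlo_pos
    have := R.one_lt_ϱ
    nlinarith

lemma inner_Q_ge {k j : ℕ} (hj : j ≤ R.last k) (u : X) :
    R.γlo * ‖u‖ ^ 2 ≤ inner ℝ u (R.Q k j u) :=
  le_trans (by gcongr; exact R.γlo_le k j hj) (R.Q_lower k j hj u)

lemma inner_Q_nonneg {k j : ℕ} (hj : j ≤ R.last k) (u : X) : 0 ≤ inner ℝ u (R.Q k j u) :=
  le_trans (mul_nonneg R.γlo_pos.le (sq_nonneg _)) (R.inner_Q_ge hj u)

lemma trial_mem (hlam : 0 < M.lam) {k j : ℕ} (hj : j ≤ R.last k) :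
    R.trial k j ∈ effDom M.h :=
  mem_effDom_of_surrogate_lt_top hlam ((R.inexact_decrease k j hj).trans_le le_top)

lemma opt_mem (hlam : 0 < M.lam) {k j : ℕ} (hj : j ≤ R.last k) : R.opt k j ∈ effDom M.h :=
  mem_effDom_of_surrogate_lt_top hlam ((R.opt_isMin k j hj (R.trial k j)).trans_lt
    ((R.inexact_decrease k j hj).trans_le le_top))

lemma x_succ_mem (hlam : 0 < M.lam) (k : ℕ) : R.x (k + 1) ∈ effDom M.h := by
  rw [R.x_succ]; exact R.trial_mem hlam le_rfl

variable {R}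

lemma surrogateReal_opt_le (hM : M.BasicAssumption) (hlam : 0 < M.lam) {k j : ℕ}
    (hj : j ≤ R.last k) {y : X} (hy : y ∈ effDom M.h) :
    M.surrogateReal (R.x k) (R.Q k j) (R.opt k j) ≤ M.surrogateReal (R.x k) (R.Q k j) y := by
  have := R.opt_isMin k j hj y
  rw [← hM.coe_surrogateReal (R.opt_mem hlam hj), ← hM.coe_surrogateReal hy] at this
  exact_mod_cast this

lemma surrogateReal_trial_lt (hM : M.BasicAssumption) (hlam : 0 < M.lam) {k j : ℕ}
    (hj : j ≤ R.last (k + 1)) :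
    M.surrogateReal (R.x (k + 1)) (R.Q (k + 1) j) (R.trial (k + 1) j)
      < M.objReal (R.x (k + 1)) := by
  have := R.inexact_decrease (k + 1) j hj
  rw [← hM.coe_surrogateReal (R.trial_mem hlam hj), ← hM.coe_objReal (R.x_succ_mem hlam k)] at this
  exact_mod_cast this

lemma surrogateReal_gap (hM : M.BasicAssumption) (hlam : 0 < M.lam) {k j : ℕ}
    (hj : j ≤ R.last (k + 1)) :
    M.surrogateReal (R.x (k + 1)) (R.Q (k + 1) j) (R.trial (k + 1) j)
      - M.surrogateReal (R.x (k + 1)) (R.Q (k + 1) j) (R.opt (k + 1) j)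
      ≤ R.μ (k + 1) / 2 * (M.objReal (R.x (k + 1))
        - M.surrogateReal (R.x (k + 1)) (R.Q (k + 1) j) (R.trial (k + 1) j)) := by
  have := R.inexact_gap (k + 1) j hj
  rw [← hM.coe_surrogateReal (R.trial_mem hlam hj), ← hM.coe_objReal (R.x_succ_mem hlam k),
    ← hM.coe_surrogateReal (R.opt_mem hlam hj)] at this
  exact_mod_cast this

lemma objReal_succ_le (hM : M.BasicAssumption) (hlam : 0 < M.lam) (k : ℕ) :
    M.objReal (R.x (k + 1))
      ≤ M.surrogateReal (R.x k) (R.Q k (R.last k)) (R.x (k + 1)) := by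
  have := R.accepted k
  rw [← R.x_succ, ← hM.coe_surrogateReal (R.x_succ_mem hlam k),
    ← hM.coe_objReal (R.x_succ_mem hlam k)] at this
  exact_mod_cast this

lemma objReal_lt (hM : M.BasicAssumption) (hlam : 0 < M.lam) (k : ℕ) :
    M.objReal (R.x (k + 2)) < M.objReal (R.x (k + 1)) := by
  have h1 := objReal_succ_le (R := R) hM hlam (k + 1)
  have h2 := surrogateReal_trial_lt (R := R) hM hlam (k := k) le_rfl
  rw [← R.x_succ] at h2
  exact h1.trans_lt h2

lemma objReal_le_first (hM : M.BasicAssumption) (hlam : 0 < M.lam) (k : ℕ) :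
    M.objReal (R.x (k + 1)) ≤ M.objReal (R.x 1) := by
  induction k with
  | zero => rfl
  | succ k ih => exact (objReal_lt hM hlam k).le.trans ih

/-- All the points generated from the second iterate on stay in a compact convex subset of the
domain of `h`. -/
theorem exists_compact [FiniteDimensional ℝ X] (hM : M.BasicAssumption) (hν : 0 ≤ M.ν)
    (hlam : 0 < M.lam) (hbdd : Bornology.IsBounded (range R.x)) :
    ∃ K : Set X, IsCompact K ∧ Convex ℝ K ∧ K ⊆ effDom M.h ∧ ∀ k, R.x (k + 1) ∈ K ∧
      ∀ j ≤ R.last (k + 1), R.trial (k + 1) j ∈ K ∧ R.opt (k + 1) j ∈ K := by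
  obtain ⟨ρ, hρ⟩ := hbdd.exists_norm_le
  obtain ⟨cψ, hψ⟩ := hM.exists_le_ψ
  obtain ⟨ch, hch⟩ := hM.exists_le_hReal
  -- The reference value is taken at `x 1`: the starting point is only known to lie in `O`, and `Θ`
  -- may be infinite there.
  set c0 := M.objReal (R.x 1)
  set d := c0 - M.ν * cψ - M.lam * ch
  set S := {x | M.h x ≤ (((c0 - M.ν * cψ) / M.lam : ℝ) : EReal)} ∩
    Metric.closedBall (0 : X) (ρ + √(2 * d / R.γlo))
  -- The constant and the weighted absolute value in the surrogate are nonnegative and `ψ`, `h` are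
  -- bounded below. A bound on the surrogate therefore bounds both `h y` and the proximal term.
  have key : ∀ k, ∀ j ≤ R.last (k + 1), ∀ y ∈ effDom M.h,
      M.surrogateReal (R.x (k + 1)) (R.Q (k + 1) j) y ≤ c0 → y ∈ S := by
    intro k j hj y hy hle
    have h1 := hM.surrogateConst_nonneg (R.x (k + 1))
    have h2 := hM.inner_gradVartheta_abs_nonneg (M.F (R.x (k + 1))) (M.linF y (R.x (k + 1)))
    have h3 := mul_le_mul_of_nonneg_left (hψ (M.linT y (R.x (k + 1)))) hν
    have h4 := R.inner_Q_ge hj (y - R.x (k + 1))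
    have h5 := mul_le_mul_of_nonneg_left (hch y hy) hlam.le
    have hγ := R.γlo_pos
    have h6 : 0 ≤ R.γlo * ‖y - R.x (k + 1)‖ ^ 2 := by positivity
    simp only [surrogateReal] at hle
    refine ⟨?_, ?_⟩
    · change M.h y ≤ _
      rw [← hM.coe_hReal hy, EReal.coe_le_coe_iff, le_div_iff₀ hlam]
      linarith
    · rw [mem_closedBall_zero_iff]
      have h7 : ‖y - R.x (k + 1)‖ ≤ √(2 * d / R.γlo) := by
        refine Real.le_sqrt_of_sq_le ?_
        rw [le_div_iff₀ hγ]
        linarith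
      calc ‖y‖ = ‖R.x (k + 1) + (y - R.x (k + 1))‖ := by congr 1; abel
        _ ≤ _ := (norm_add_le _ _).trans (add_le_add (hρ _ ⟨_, rfl⟩) h7)
  refine ⟨S, hM.isCompact_sublevel _ _, hM.convex_sublevel _ _, sublevel_subset_effDom _ _,
    fun k => ⟨key k 0 (Nat.zero_le _) _ (R.x_succ_mem hlam k) ?_, fun j hj =>
      ⟨key k j hj _ (R.trial_mem hlam hj) ?_, key k j hj _ (R.opt_mem hlam hj) ?_⟩⟩⟩
  · rw [surrogateReal_self]; exact objReal_le_first hM hlam k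
  · exact (surrogateReal_trial_lt hM hlam hj).le.trans (objReal_le_first hM hlam k)
  · exact (surrogateReal_opt_le hM hlam hj (R.trial_mem hlam hj)).trans
      ((surrogateReal_trial_lt hM hlam hj).le.trans (objReal_le_first hM hlam k))

/-- The accepted proximal parameters are bounded. -/
theorem exists_γ_le [FiniteDimensional ℝ X] (hM : M.BasicAssumption) (hν : 0 ≤ M.ν)
    (hlam : 0 < M.lam) (hbdd : Bornology.IsBounded (range R.x))
    (hF : ContDiffOn ℝ 2 M.F M.O) (hT : ContDiffOn ℝ 2 M.T M.O) :
    ∃ γt : ℝ, 0 < γt ∧ ∀ k, R.γ k (R.last k) ≤ γt := by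
  obtain ⟨K, hK, hKc, hKD, hmem⟩ := exists_compact hM hν hlam hbdd
  obtain ⟨C, hC, hmaj⟩ := hM.exists_majorization hν hF hT hK hKc hKD
  have hϱ := R.one_lt_ϱ
  have key : ∀ k, R.γ (k + 1) (R.last (k + 1)) ≤ max R.γhi (R.ϱ * (2 * C)) := by
    intro k
    rcases Nat.eq_zero_or_pos (R.last (k + 1)) with h0 | h0
    · rw [h0]; exact (R.γ_zero_mem (k + 1)).2.trans (le_max_left _ _)
    · obtain ⟨j, hj⟩ := Nat.exists_eq_succ_of_ne_zero h0.ne'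
      obtain ⟨h1, h2⟩ := R.rejected (k + 1) j (by omega)
      have hjl : j ≤ R.last (k + 1) := by omega
      rw [hj, Nat.succ_eq_add_one, h2]
      refine le_trans ?_ (le_max_right _ _)
      gcongr
      rw [← hM.coe_surrogateReal (R.trial_mem hlam hjl), ← hM.coe_objReal (R.trial_mem hlam hjl),
        EReal.coe_lt_coe_iff] at h1
      have h3 := hmaj _ ((hmem k).2 j hjl).1 _ (hmem k).1 (R.Q (k + 1) j)
      have h4 := R.Q_lower (k + 1) j hjl (R.trial (k + 1) j - R.x (k + 1))
      set e := ‖R.trial (k + 1) j - R.x (k + 1)‖ ^ 2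
      have he : 0 ≤ e := sq_nonneg _
      -- Rejection and majorization force `⟪e, Q e⟫ < 2 * C * ‖e‖ ^ 2` for the step `e` of the
      -- trial, impossible if the rejected parameter exceeds `2 * C`.
      by_contra hcon
      push Not at hcon
      nlinarith
  -- Iteration `0` starts outside the control of `K`, so its single accepted parameter is added to
  -- the maximum.
  refine ⟨max (max R.γhi (R.ϱ * (2 * C))) (R.γ 0 (R.last 0)), ?_, fun k => ?_⟩
  · exact (R.γlo_pos.trans R.γlo_lt_γhi).trans_le ((le_max_left _ _).trans (le_max_left _ _))
  · cases k with
    | zero => exact le_max_right _ _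
    | succ k => exact (key k).trans (le_max_left _ _)

/-- The sufficient decrease of the objective along the iterates. -/
theorem exists_descent [FiniteDimensional ℝ X] (hM : M.BasicAssumption) (hν : 0 ≤ M.ν)
    (hlam : 0 < M.lam) :
    ∃ C : ℝ, 0 < C ∧ ∀ k,
      ‖R.opt (k + 1) (R.last (k + 1)) - R.x (k + 1)‖
        ≤ C * √(M.objReal (R.x (k + 1)) - M.objReal (R.x (k + 2))) ∧
      ‖R.x (k + 2) - R.x (k + 1)‖
        ≤ C * √(M.objReal (R.x (k + 1)) - M.objReal (R.x (k + 2))) ∧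
      M.objReal (R.x (k + 2)) ≤ M.surrogateReal (R.x (k + 1)) (R.Q (k + 1) (R.last (k + 1)))
        (R.opt (k + 1) (R.last (k + 1)))
        + C * (M.objReal (R.x (k + 1)) - M.objReal (R.x (k + 2))) ∧
      M.surrogateReal (R.x (k + 1)) (R.Q (k + 1) (R.last (k + 1)))
        (R.opt (k + 1) (R.last (k + 1))) ≤ M.objReal (R.x (k + 1)) := by
  have hγ := R.γlo_pos
  have hμ := R.μbar_pos
  -- Acceptance and the inexactness gap give `o0 - S0 ≤ (1 + μbar / 2) * (o0 - o1)`, where `S0` is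
  -- the minimal surrogate value and `o0`, `o1` are consecutive objective values. Quadratic growth
  -- with modulus `γlo` converts this into distances to the minimizer.
  set C1 := √(2 * (1 + R.μbar / 2) / R.γlo) with hC1
  have hC1p : 0 < C1 := Real.sqrt_pos.2 (by positivity)
  have bound : ∀ (u : X) (δ : ℝ), 0 ≤ δ → R.γlo * ‖u‖ ^ 2 ≤ 2 * ((1 + R.μbar / 2) * δ) →
      ‖u‖ ≤ C1 * √δ := by
    intro u δ hδ h
    rw [hC1, ← Real.sqrt_mul (by positivity)]
    refine Real.le_sqrt_of_sq_le ?_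
    rw [div_mul_eq_mul_div, le_div_iff₀ hγ]
    linarith
  refine ⟨2 * C1 + R.μbar / 2, by positivity, fun k => ?_⟩
  have g1 := surrogateReal_gap (R := R) hM hlam (k := k) le_rfl
  have g2 := objReal_succ_le (R := R) hM hlam (k + 1)
  have g3 := surrogateReal_trial_lt (R := R) hM hlam (k := k) le_rfl
  have hmin := fun y (hy : y ∈ effDom M.h) =>
    surrogateReal_opt_le (R := R) hM hlam (k := k + 1) le_rfl hy
  have gr := fun y (hy : y ∈ effDom M.h) => hM.surrogateReal_growth hν hlam
    (R.Q_symm (k + 1) _ le_rfl) (R.inner_Q_nonneg le_rfl) (R.opt_mem hlam le_rfl) hmin hy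
  rw [← R.x_succ] at g1 g3
  have e1 := gr _ (R.x_succ_mem hlam k)
  have e2 := gr _ (R.x_succ_mem hlam (k + 1))
  have q1 := R.inner_Q_ge (k := k + 1) le_rfl (R.x (k + 1) - R.opt (k + 1) (R.last (k + 1)))
  have q2 := R.inner_Q_ge (k := k + 1) le_rfl (R.x (k + 1 + 1) - R.opt (k + 1) (R.last (k + 1)))
  have m1 := hmin _ (R.x_succ_mem hlam k)
  rw [surrogateReal_self] at e1 m1
  have hμk := (R.μ_mem (k + 1))
  change ‖_ - _‖ ≤ (2 * C1 + _) * √(_ - M.objReal (R.x (k + 1 + 1))) ∧ ‖R.x (k + 1 + 1) - _‖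
    ≤ (2 * C1 + _) * √(_ - M.objReal (R.x (k + 1 + 1))) ∧
    M.objReal (R.x (k + 1 + 1)) ≤ _ + _ * (_ - M.objReal (R.x (k + 1 + 1))) ∧ _
  generalize M.surrogateReal (R.x (k + 1)) (R.Q (k + 1) (R.last (k + 1)))
    (R.x (k + 1 + 1)) = S1 at *
  generalize M.surrogateReal (R.x (k + 1)) (R.Q (k + 1) (R.last (k + 1)))
    (R.opt (k + 1) (R.last (k + 1))) = S0 at *
  generalize M.objReal (R.x (k + 1 + 1)) = o1 at *
  generalize M.objReal (R.x (k + 1)) = o0 at *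
  have hδ : 0 ≤ o0 - o1 := by linarith
  have hgap : S1 - S0 ≤ R.μbar / 2 * (o0 - o1) := by
    refine g1.trans ?_
    have : R.μ (k + 1) ≤ R.μbar := hμk.2
    gcongr
  have b1 := bound (R.x (k + 1) - R.opt (k + 1) (R.last (k + 1))) (o0 - o1) hδ (by linarith)
  have b2 := bound (R.x (k + 1 + 1) - R.opt (k + 1) (R.last (k + 1))) (o0 - o1) hδ (by linarith)
  have hs : 0 ≤ √(o0 - o1) := Real.sqrt_nonneg _
  have hs' : 0 ≤ R.μbar / 2 * √(o0 - o1) := by positivity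
  have hs'' : 0 ≤ C1 * √(o0 - o1) := by positivity
  refine ⟨?_, ?_, ?_, m1⟩
  · rw [norm_sub_rev]
    linarith
  · calc ‖R.x (k + 1 + 1) - R.x (k + 1)‖
        = ‖(R.x (k + 1 + 1) - R.opt (k + 1) (R.last (k + 1)))
          - (R.x (k + 1) - R.opt (k + 1) (R.last (k + 1)))‖ := by congr 1; abel
      _ ≤ C1 * √(o0 - o1) + C1 * √(o0 - o1) := (norm_sub_le _ _).trans (add_le_add b2 b1)
      _ ≤ _ := by linarith
  · have : 0 ≤ C1 * (o0 - o1) := by positivity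
    linarith

end IPMMRun

end CompositeModel

/-! ### Subgradients of the potential -/

/-- Cauchy-Schwarz for the form of `Q`, obtained from its nonnegativity at `‖d‖ • u - ‖u‖ • d`. -/
lemma LinearMap.inner_map_le_of_inner_self_le {X : Type*} [NormedAddCommGroup X]
    [InnerProductSpace ℝ X] {Q : X →ₗ[ℝ] X} (hQs : Q.IsSymmetric)
    (hQ : ∀ u, 0 ≤ inner ℝ u (Q u)) {c : ℝ} (hc : ∀ u, inner ℝ u (Q u) ≤ c * ‖u‖ ^ 2) (u d : X) :
    inner ℝ (Q u) d ≤ c * ‖u‖ * ‖d‖ := by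
  rcases eq_or_ne u 0 with rfl | hu
  · simp
  rcases eq_or_ne d 0 with rfl | hd
  · simp
  have hu' : 0 < ‖u‖ := norm_pos_iff.2 hu
  have hd' : 0 < ‖d‖ := norm_pos_iff.2 hd
  have h := hQ (‖d‖ • u - ‖u‖ • d)
  have h1 := mul_le_mul_of_nonneg_left (hc u) (sq_nonneg ‖d‖)
  have h2 := mul_le_mul_of_nonneg_left (hc d) (sq_nonneg ‖u‖)
  have h3 : inner ℝ d (Q u) = inner ℝ (Q u) d := real_inner_comm _ _
  simp only [map_sub, map_smul, inner_sub_left, inner_sub_right, real_inner_smul_left,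
    real_inner_smul_right, ← hQs u d, h3] at h
  have h4 : ‖u‖ * ‖d‖ * inner ℝ (Q u) d ≤ ‖u‖ * ‖d‖ * (c * ‖u‖ * ‖d‖) := by nlinarith
  exact le_of_mul_le_mul_left h4 (by positivity)

namespace CompositeModel

variable {X : Type*} [NormedAddCommGroup X] [InnerProductSpace ℝ X] {m n p q : ℕ}
  {M : CompositeModel X m n p q}

namespace Triple

section Maps

variable {X : Type*} [NormedAddCommGroup X] [InnerProductSpace ℝ X]

/-- The first coordinate as a continuous linear map. -/
noncomputable def fstL : Triple X →L[ℝ] X := WithLp.fstL 2 ℝ X (WithLp 2 (X × ℝ))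

/-- The second coordinate as a continuous linear map. -/
noncomputable def sndL : Triple X →L[ℝ] X :=
  (WithLp.fstL 2 ℝ X ℝ).comp (WithLp.sndL 2 ℝ X (WithLp 2 (X × ℝ)))

/-- The third coordinate as a continuous linear map. -/
noncomputable def thdL : Triple X →L[ℝ] ℝ :=
  (WithLp.sndL 2 ℝ X ℝ).comp (WithLp.sndL 2 ℝ X (WithLp 2 (X × ℝ)))

@[simp] lemma fstL_apply (w : Triple X) : fstL w = w.fst := rfl
@[simp] lemma sndL_apply (w : Triple X) : sndL w = w.snd.fst := rfl
@[simp] lemma thdL_apply (w : Triple X) : thdL w = w.snd.snd := rfl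

end Maps

section Norms

variable {X : Type*} [NormedAddCommGroup X]

lemma norm_fst_le (w : Triple X) : ‖w.fst‖ ≤ ‖w‖ := WithLp.norm_fst_le _ w

lemma norm_snd_fst_le (w : Triple X) : ‖w.snd.fst‖ ≤ ‖w‖ :=
  (WithLp.norm_fst_le _ _).trans (WithLp.norm_snd_le _ w)

lemma abs_snd_snd_le (w : Triple X) : |w.snd.snd| ≤ ‖w‖ :=
  (WithLp.norm_snd_le _ w.snd).trans (WithLp.norm_snd_le _ w)

end Norms

section Mk

variable {X : Type*}

/-- The triple `(x, z, t)`. -/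
def mk (x z : X) (t : ℝ) : Triple X := WithLp.toLp 2 (x, WithLp.toLp 2 (z, t))

@[simp] lemma mk_fst (x z : X) (t : ℝ) : (mk x z t).fst = x := rfl
@[simp] lemma mk_snd_fst (x z : X) (t : ℝ) : (mk x z t).snd.fst = z := rfl
@[simp] lemma mk_snd_snd (x z : X) (t : ℝ) : (mk x z t).snd.snd = t := rfl

lemma continuous_mk [NormedAddCommGroup X] :
    Continuous fun y : X × X × ℝ => mk y.1 y.2.1 y.2.2 := by
  unfold mk
  fun_prop

end Mk

end Triple

open Triple

/-- The derivative of the linearization `(x, z) ↦ G z + G'(z) (x - z)`. -/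
noncomputable def linearizationDeriv {V : Type*} [NormedAddCommGroup V] [NormedSpace ℝ V]
    (G : X → V) (x z : X) : Triple X →L[ℝ] V :=
  (fderiv ℝ G z).comp fstL + ((fderiv ℝ (fderiv ℝ G) z).comp sndL).flip (x - z)

lemma linearizationDeriv_apply {V : Type*} [NormedAddCommGroup V] [NormedSpace ℝ V]
    (G : X → V) (x z : X) (d : Triple X) : linearizationDeriv G x z d
      = fderiv ℝ G z d.fst + fderiv ℝ (fderiv ℝ G) z d.snd.fst (x - z) := rfl

lemma hasFDerivAt_linearization {V : Type*} [NormedAddCommGroup V] [NormedSpace ℝ V]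
    {G : X → V} {O : Set X} (hG : ContDiffOn ℝ 2 G O) (hO : IsOpen O) {w : Triple X}
    (hw : w.snd.fst ∈ O) :
    HasFDerivAt (fun w : Triple X => G w.snd.fst + fderiv ℝ G w.snd.fst (w.fst - w.snd.fst))
      (linearizationDeriv G w.fst w.snd.fst) w := by
  have hG1 : ContDiffOn ℝ 1 (fderiv ℝ G) O := hG.fderiv_of_isOpen hO (by norm_num)
  have hs : HasFDerivAt (fun w : Triple X => w.snd.fst) (sndL : Triple X →L[ℝ] X) w :=
    sndL.hasFDerivAt
  have hf : HasFDerivAt (fun w : Triple X => w.fst) (fstL : Triple X →L[ℝ] X) w :=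
    fstL.hasFDerivAt
  have h1 : HasFDerivAt G (fderiv ℝ G w.snd.fst) w.snd.fst :=
    ((hG.differentiableOn (by norm_num)).differentiableAt (hO.mem_nhds hw)).hasFDerivAt
  have h2 : HasFDerivAt (fderiv ℝ G) (fderiv ℝ (fderiv ℝ G) w.snd.fst) w.snd.fst :=
    ((hG1.differentiableOn (by norm_num)).differentiableAt (hO.mem_nhds hw)).hasFDerivAt
  have h1' := h1.comp w hs
  have h2' := (h2.comp w hs).clm_apply (hf.sub hs)
  -- The derivative of `G` in the direction of the second coordinate cancels against the inner
  -- derivative of `w.fst - w.snd.fst`; only the second-derivative term survives there.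
  refine (h1'.add h2').congr_fderiv ?_
  ext d
  simp only [linearizationDeriv_apply]
  simp
  abel

/-- Only `θ` is expanded; the absolute values stay unlinearized, being merely Lipschitz. Their kinks
are handled by subgradients afterwards. -/
lemma _root_.MemFamilyL.isLittleO_vartheta {θ : ℝ → ℝ} (hθ : MemFamilyL θ) {E : Type*}
    [NormedAddCommGroup E] [NormedSpace ℝ E] {a b : ℕ} {G : E → FMat a b} {G' : E →L[ℝ] FMat a b}
    {w : E} (hG : HasFDerivAt G G' w) :
    (fun w' => vartheta θ (G w').abs - vartheta θ (G w).abs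
      - inner ℝ (gradVartheta θ (G w).abs) ((G w').abs - (G w).abs)) =o[𝓝 w] fun w' => w' - w := by
  have e : (fun w' => vartheta θ (G w').abs - vartheta θ (G w).abs
      - inner ℝ (gradVartheta θ (G w).abs) ((G w').abs - (G w).abs)) = fun w' =>
      ∑ ij, (θ |G w' ij| - θ |G w ij| - (|G w' ij| - |G w ij|) * deriv θ |G w ij|) := by
    ext w'
    rw [FMat.inner_eq_sum, vartheta, vartheta, ← Finset.sum_sub_distrib, ← Finset.sum_sub_distrib]
    refine Finset.sum_congr rfl fun ij _ => ?_
    simp [mul_comm]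
  rw [e]
  refine Asymptotics.IsLittleO.fun_sum fun ij _ => ?_
  have h1 := hasDerivAt_iff_isLittleO.1 (hθ.hasDerivAt (abs_nonneg (G w ij)))
  have hc : Tendsto (fun w' => |G w' ij|) (𝓝 w) (𝓝 |G w ij|) := by
    have : ContinuousAt (fun w' => G w' ij) w :=
      (by fun_prop : Continuous fun z : FMat a b => z ij).continuousAt.comp hG.continuousAt
    exact this.abs
  have h2 := h1.comp_tendsto hc
  have h3 : (fun w' => |G w' ij| - |G w ij|) =O[𝓝 w] fun w' => w' - w := by
    refine Asymptotics.IsBigO.trans (g := fun w' => G w' - G w) (Asymptotics.IsBigO.of_bound 1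
      (Eventually.of_forall fun w' => ?_)) hG.isBigO_sub
    rw [one_mul, Real.norm_eq_abs]
    refine (abs_abs_sub_abs_le _ _).trans ?_
    simpa using FMat.abs_apply_le_norm (G w' - G w) ij
  exact h2.trans_isBigO h3

/-- The linear functional that represents the subgradient of the potential built from the
multipliers `g`, `u` and `η`. -/
noncomputable def potentialFunctional (M : CompositeModel X m n p q) (γ : ℝ) (w : Triple X)
    (g : FMat m n) (u : FMat p q) (η : X) : Triple X →L[ℝ] ℝ :=
  (innerSL ℝ g).comp (linearizationDeriv M.F w.fst w.snd.fst)
    + M.ν • (innerSL ℝ u).comp (linearizationDeriv M.T w.fst w.snd.fst)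
    + M.lam • (innerSL ℝ η).comp fstL
    + γ • (innerSL ℝ (w.fst - w.snd.fst)).comp (fstL - sndL) + (2 * w.snd.snd) • thdL

lemma potentialFunctional_apply (γ : ℝ) (w : Triple X)
    (g : FMat m n) (u : FMat p q) (η : X) (d : Triple X) :
    M.potentialFunctional γ w g u η d
      = inner ℝ g (linearizationDeriv M.F w.fst w.snd.fst d)
        + M.ν * inner ℝ u (linearizationDeriv M.T w.fst w.snd.fst d)
        + M.lam * inner ℝ η d.fst + γ * inner ℝ (w.fst - w.snd.fst) (d.fst - d.snd.fst)
        + 2 * w.snd.snd * d.snd.snd := by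
  simp [potentialFunctional, inner_sub_left, inner_sub_right]

/-- After replacing `ϑ` by its tangent and the linearization maps by their derivatives, at a cost of
`o(‖w' - w‖)`, every remaining piece is convex: the absolute values with weights `θ' ≥ 0`, `ψ`, `h`
and the two squares. Their subgradient inequalities add up. -/
theorem BasicAssumption.mem_regularSubdiff_potential (hM : M.BasicAssumption) (hν : 0 ≤ M.ν)
    (hlam : 0 < M.lam) (hF : ContDiffOn ℝ 2 M.F M.O) (hT : ContDiffOn ℝ 2 M.T M.O)
    {γ : ℝ} (hγ : 0 ≤ γ) {w : Triple X} (hw : w.fst ∈ effDom M.h) (hwO : w.snd.fst ∈ M.O)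
    {s : FMat m n} {u : FMat p q} {η : X}
    (hs : ∀ ij, IsSubgradientOn univ (fun t : ℝ => |t|) (M.linF w.fst w.snd.fst ij) (s ij))
    (hu : IsSubgradientOn univ M.ψ (M.linT w.fst w.snd.fst) u)
    (hη : IsSubgradientOn (effDom M.h) M.hReal w.fst η) {v : Triple X}
    (hv : ∀ d, inner ℝ v d = M.potentialFunctional γ w
      (FMat.hadamard (gradVartheta M.θ (M.linF w.fst w.snd.fst).abs) s) u η d) :
    v ∈ regularSubdiff (M.potential γ) w := by
  set g := FMat.hadamard (gradVartheta M.θ (M.linF w.fst w.snd.fst).abs) s with hg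
  refine ⟨?_, ?_, fun ε hε => ?_⟩
  · rw [← hM.coe_potentialReal hw]; exact EReal.coe_ne_bot _
  · rw [← hM.coe_potentialReal hw]; exact EReal.coe_ne_top _
  have dF : HasFDerivAt (fun w : Triple X => M.linF w.fst w.snd.fst)
    (linearizationDeriv M.F w.fst w.snd.fst) w := hasFDerivAt_linearization hF hM.O_open hwO
  have dT : HasFDerivAt (fun w : Triple X => M.linT w.fst w.snd.fst)
    (linearizationDeriv M.T w.fst w.snd.fst) w := hasFDerivAt_linearization hT hM.O_open hwO
  have o1 := hM.θ_mem.isLittleO_vartheta dF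
  have o2 := ((innerSL ℝ g).hasFDerivAt.comp w dF).isLittleO
  have o3 := (((innerSL ℝ u).hasFDerivAt.comp w dT).isLittleO).const_mul_left M.ν
  have o := ((o1.add o2).add o3).def hε
  filter_upwards [o] with w' ho
  by_cases hw' : w'.fst ∈ effDom M.h
  swap
  · rw [potential_eq_top hlam hw']; exact le_top
  rw [← hM.coe_potentialReal hw, ← hM.coe_potentialReal hw', ← EReal.coe_add,
    EReal.coe_le_coe_iff, hv, potentialFunctional_apply]
  rw [Real.norm_eq_abs] at ho
  have ho' := (abs_le.1 ho).1
  simp only [Function.comp_apply, ContinuousLinearMap.comp_apply, innerSL_apply_apply] at ho'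
  have k1 : inner ℝ g (M.linF w'.fst w'.snd.fst - M.linF w.fst w.snd.fst)
      ≤ inner ℝ (gradVartheta M.θ (M.linF w.fst w.snd.fst).abs)
        ((M.linF w'.fst w'.snd.fst).abs - (M.linF w.fst w.snd.fst).abs) := by
    simp only [FMat.inner_eq_sum]
    refine Finset.sum_le_sum fun ij _ => ?_
    have := mul_le_mul_of_nonneg_left (hs ij (M.linF w'.fst w'.snd.fst ij) (mem_univ _))
      (hM.θ_mem.gradVartheta_nonneg (M.linF w.fst w.snd.fst) ij)
    simp only [hg, Real.inner_apply, FMat.hadamard_apply, PiLp.sub_apply, FMat.abs_apply] at this ⊢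
    linarith
  have k2 := mul_le_mul_of_nonneg_left (hu (M.linT w'.fst w'.snd.fst) (mem_univ _)) hν
  have k3 := mul_le_mul_of_nonneg_left (hη w'.fst hw') hlam.le
  have e1 : (w' - w).fst = w'.fst - w.fst := rfl
  have e2 : (w' - w).snd.fst = w'.snd.fst - w.snd.fst := rfl
  have e3 : (w' - w).snd.snd = w'.snd.snd - w.snd.snd := rfl
  have k4 : γ / 2 * ‖w.fst - w.snd.fst‖ ^ 2
      + γ * inner ℝ (w.fst - w.snd.fst) ((w' - w).fst - (w' - w).snd.fst)
      ≤ γ / 2 * ‖w'.fst - w'.snd.fst‖ ^ 2 := by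
    rw [e1, e2]
    have e : w'.fst - w'.snd.fst = (w.fst - w.snd.fst)
        + (w'.fst - w.fst - (w'.snd.fst - w.snd.fst)) := by abel
    rw [e, norm_add_sq_real]
    have := mul_nonneg hγ (sq_nonneg ‖w'.fst - w.fst - (w'.snd.fst - w.snd.fst)‖)
    linarith
  have k5 : w.snd.snd ^ 2 + 2 * w.snd.snd * (w' - w).snd.snd ≤ w'.snd.snd ^ 2 := by
    rw [e3]
    nlinarith [sq_nonneg (w'.snd.snd - w.snd.snd)]
  rw [← e1] at k3
  simp only [inner_sub_right] at k1 k2 ho'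
  simp only [potentialReal]
  linarith

variable [FiniteDimensional ℝ X]

/-- A subgradient of the potential at the triples built from the minimizer `a` of a subproblem. -/
theorem BasicAssumption.exists_subgradient_potential (hM : M.BasicAssumption) (hν : 0 ≤ M.ν)
    (hlam : 0 < M.lam) (hF : ContDiffOn ℝ 2 M.F M.O) (hT : ContDiffOn ℝ 2 M.T M.O)
    {γ : ℝ} (hγ : 0 ≤ γ) {K : Set X} (hK : IsCompact K) (hKc : Convex ℝ K)
    (hKD : K ⊆ effDom M.h) {c : ℝ} (hc0 : 0 ≤ c) :
    ∃ C : ℝ, 0 ≤ C ∧ ∀ a ∈ K, ∀ z ∈ K, ∀ Q : X →ₗ[ℝ] X, Q.IsSymmetric →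
      (∀ u, 0 ≤ inner ℝ u (Q u)) → (∀ u, inner ℝ u (Q u) ≤ c * ‖u‖ ^ 2) →
      (∀ x ∈ effDom M.h, M.surrogateReal z Q a ≤ M.surrogateReal z Q x) → ∀ t : ℝ,
      ∃ v ∈ regularSubdiff (M.potential γ) (Triple.mk a z t), ‖v‖ ≤ C * ‖a - z‖ + 2 * |t| := by
  obtain ⟨B, hB, hFB⟩ := hF.exists_linearization_bounds hM.O_open hK hKc (hKD.trans hM.dom_subset)
  obtain ⟨B', hB', hTB⟩ := hT.exists_linearization_bounds hM.O_open hK hKc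
    (hKD.trans hM.dom_subset)
  obtain ⟨G, hG, hgrad⟩ := hM.θ_mem.exists_norm_gradVartheta_le m n
  obtain ⟨L, hL, hlip⟩ := hM.θ_mem.exists_lipschitz_gradVartheta m n B
  obtain ⟨W, hW, hsub⟩ := exists_norm_le_of_isSubgradientOn hM.ψ_convex B'
  have : CompleteSpace X := FiniteDimensional.complete ℝ X
  refine ⟨L * B * B + G * B + M.ν * (W * B') + c + 2 * γ, by positivity,
    fun a ha z hz Q hQs hQ hQc hmin t => ?_⟩
  obtain ⟨s, u, η, hs, hu, hη, h0⟩ := hM.exists_multipliers hν hlam hQs hQ (hKD ha) hmin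
  have hs1 : ∀ ij, |s ij| ≤ 1 := fun ij => (hs ij).abs_le_one
  set g := FMat.hadamard (gradVartheta M.θ (M.linF a z).abs) s with hg
  set g0 := FMat.hadamard (gradVartheta M.θ (M.F z).abs) s with hg0
  set φ := M.potentialFunctional γ (Triple.mk a z t) g u η with hφ
  set v := (InnerProductSpace.toDual ℝ (Triple X)).symm φ with hv
  have hvφ : ∀ d, inner ℝ v d = φ d := fun d => InnerProductSpace.toDual_symm_apply
  refine ⟨v, hM.mem_regularSubdiff_potential (w := Triple.mk a z t) hν hlam hF hT hγ (hKD ha)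
    (hM.dom_subset (hKD hz)) hs hu hη hvφ, ?_⟩
  -- The potential weights its absolute values by `θ'` at `ℓ_F(a; z)`, the subproblem by `θ'` at `F
  -- z`; the discrepancy is of order `‖a - z‖`.
  have hgg : ‖g - g0‖ ≤ L * (B * ‖a - z‖) := by
    refine (hlip (M.linF a z) (M.F z) s ((hFB z hz).2.2 a ha).1 ?_ hs1).trans ?_
    · simpa using ((hFB z hz).2.2 z hz).1
    · refine mul_le_mul_of_nonneg_left ?_ hL
      rw [linF, add_sub_cancel_left]
      exact (ContinuousLinearMap.le_opNorm _ _).trans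
        (mul_le_mul_of_nonneg_right (hFB z hz).1 (norm_nonneg _))
  have hgn : ‖g‖ ≤ G := hgrad _ _ hs1
  have hun : ‖u‖ ≤ W := hsub _ _ ((hTB z hz).2.2 a ha).1 hu
  have second : ∀ {V : Type} [NormedAddCommGroup V] [InnerProductSpace ℝ V] (H : X → V) (b b' : ℝ)
      (y : V) (d : Triple X), 0 ≤ b' → ‖fderiv ℝ (fderiv ℝ H) z‖ ≤ b → ‖y‖ ≤ b' →
      inner ℝ y (fderiv ℝ (fderiv ℝ H) z d.snd.fst (a - z)) ≤ b' * b * ‖a - z‖ * ‖d‖ := by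
    intro V _ _ H b b' y d hb' hb hy
    have hb0 : 0 ≤ b := (norm_nonneg (fderiv ℝ (fderiv ℝ H) z)).trans hb
    calc _ ≤ ‖y‖ * ‖fderiv ℝ (fderiv ℝ H) z d.snd.fst (a - z)‖ := real_inner_le_norm _ _
      _ ≤ b' * (b * ‖d‖ * ‖a - z‖) := by
        refine mul_le_mul hy ?_ (norm_nonneg _) hb'
        refine (ContinuousLinearMap.le_opNorm₂ _ _ _).trans ?_
        have := norm_snd_fst_le d
        gcongr
      _ = _ := by ring
  have bound : ∀ d, φ d
      ≤ ((L * B * B + G * B + M.ν * (W * B') + c + 2 * γ) * ‖a - z‖ + 2 * |t|) * ‖d‖ := by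
    intro d
    have hd1 := norm_fst_le d
    have hd2 := norm_snd_fst_le d
    have hd3 := abs_snd_snd_le d
    rw [hφ, potentialFunctional_apply, linearizationDeriv_apply, linearizationDeriv_apply]
    simp only [mk_fst, mk_snd_fst, mk_snd_snd]
    have b1 : inner ℝ (g - g0) (fderiv ℝ M.F z d.fst) ≤ L * B * B * ‖a - z‖ * ‖d‖ := by
      calc _ ≤ ‖g - g0‖ * ‖fderiv ℝ M.F z d.fst‖ := real_inner_le_norm _ _
        _ ≤ (L * (B * ‖a - z‖)) * (B * ‖d‖) := by
          refine mul_le_mul hgg ((ContinuousLinearMap.le_opNorm _ _).trans ?_) (norm_nonneg _)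
            (by positivity)
          exact mul_le_mul (hFB z hz).1 hd1 (norm_nonneg _) hB
        _ = _ := by ring
    have b2 := second M.F B G g d hG (hFB z hz).2.1 hgn
    have b3 := mul_le_mul_of_nonneg_left (second M.T B' W u d hW (hTB z hz).2.1 hun) hν
    have b4 : inner ℝ (Q (z - a)) d.fst ≤ c * ‖a - z‖ * ‖d‖ := by
      refine (LinearMap.inner_map_le_of_inner_self_le hQs hQ hQc _ _).trans ?_
      rw [norm_sub_rev]
      gcongr
    have b5 : γ * inner ℝ (a - z) (d.fst - d.snd.fst) ≤ 2 * γ * ‖a - z‖ * ‖d‖ := by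
      calc _ ≤ γ * (‖a - z‖ * (‖d‖ + ‖d‖)) := by
            refine mul_le_mul_of_nonneg_left ((real_inner_le_norm _ _).trans ?_) hγ
            gcongr
            exact (norm_sub_le _ _).trans (add_le_add hd1 hd2)
        _ = _ := by ring
    have b6 : 2 * t * d.snd.snd ≤ 2 * |t| * ‖d‖ := by
      calc _ ≤ |2 * t * d.snd.snd| := le_abs_self _
        _ = 2 * |t| * |d.snd.snd| := by rw [abs_mul, abs_mul]; norm_num
        _ ≤ _ := by gcongr
    -- The optimality identity of the subproblem eliminates the zeroth-order terms in `g0`, `u` and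
    -- `η`, leaving `Q (z - a)`.
    have h1 := h0 d.fst
    have h2 : inner ℝ (Q (z - a)) d.fst = -inner ℝ (Q (a - z)) d.fst := by
      rw [← neg_sub a z, map_neg, inner_neg_left]
    rw [inner_sub_left] at b1
    rw [inner_add_right, inner_add_right]
    linarith
  rcases (norm_nonneg v).eq_or_lt with h | h
  · rw [← h]; positivity
  · have := bound v
    rw [← hvφ, real_inner_self_eq_norm_sq, sq] at this
    exact le_of_mul_le_mul_right this h

end CompositeModel

namespace CompositeModel

variable {X : Type*} [NormedAddCommGroup X] [InnerProductSpace ℝ X] {m n p q : ℕ}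
  {M : CompositeModel X m n p q}

/-! ### Comparison of the potential with the surrogate -/

lemma potentialReal_diag (γ : ℝ) (x : X) : M.potentialReal γ (Triple.mk x x 0) = M.objReal x := by
  simp [potentialReal, objReal, linF_self, linT_self]

/-- Tangent inequality for `ϑ` at `F z`. The companion lemma below takes the tangent at `ℓ_F(a; z)`
instead and pays a quadratic error for the change of gradient. -/
lemma BasicAssumption.potentialReal_le (hM : M.BasicAssumption) {γ : ℝ} {Q : X →ₗ[ℝ] X}
    (hQ : ∀ u, 0 ≤ inner ℝ u (Q u)) (a z : X) (t : ℝ) :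
    M.potentialReal γ (Triple.mk a z t)
      ≤ M.surrogateReal z Q a + γ / 2 * ‖a - z‖ ^ 2 + t ^ 2 := by
  have h1 := hM.θ_mem.vartheta_le_tangent (M.F z) (M.linF a z)
  have h2 := hQ (a - z)
  rw [inner_sub_right] at h1
  simp only [potentialReal, surrogateReal, surrogateConst, Triple.mk_fst, Triple.mk_snd_fst,
    Triple.mk_snd_snd]
  linarith

lemma BasicAssumption.exists_surrogateReal_le_potentialReal (hM : M.BasicAssumption)
    (hF : ContDiffOn ℝ 2 M.F M.O) {γ : ℝ} (hγ : 0 ≤ γ) {K : Set X} (hK : IsCompact K)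
    (hKc : Convex ℝ K) (hKD : K ⊆ effDom M.h) {c : ℝ} (hc0 : 0 ≤ c) :
    ∃ C : ℝ, 0 ≤ C ∧ ∀ a ∈ K, ∀ z ∈ K, ∀ Q : X →ₗ[ℝ] X,
      (∀ u, inner ℝ u (Q u) ≤ c * ‖u‖ ^ 2) → ∀ t : ℝ,
      M.surrogateReal z Q a + t ^ 2 ≤ M.potentialReal γ (Triple.mk a z t) + C * ‖a - z‖ ^ 2 := by
  obtain ⟨B, hB, hFB⟩ := hF.exists_linearization_bounds hM.O_open hK hKc (hKD.trans hM.dom_subset)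
  obtain ⟨L, hL, hlip⟩ := hM.θ_mem.exists_lipschitz_gradVartheta m n B
  refine ⟨L * B * B + c / 2, by positivity, fun a ha z hz Q hQc t => ?_⟩
  have h1 := hM.θ_mem.vartheta_le_tangent (M.linF a z) (M.F z)
  have h2 : ‖M.linF a z - M.F z‖ ≤ B * ‖a - z‖ := by
    rw [linF, add_sub_cancel_left]
    exact (ContinuousLinearMap.le_opNorm _ _).trans
      (mul_le_mul_of_nonneg_right (hFB z hz).1 (norm_nonneg _))
  have h3 : ‖gradVartheta M.θ (M.F z).abs - gradVartheta M.θ (M.linF a z).abs‖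
      ≤ L * (B * ‖a - z‖) := by
    have := hlip (M.F z) (M.linF a z) (WithLp.toLp 2 fun _ => 1)
      (by simpa using ((hFB z hz).2.2 z hz).1) ((hFB z hz).2.2 a ha).1 (by simp)
    rw [norm_sub_rev (M.F z)] at this
    have e : ∀ y : FMat m n, FMat.hadamard y (WithLp.toLp 2 fun _ => 1) = y := fun y => by
      ext ij; simp
    rw [e, e] at this
    exact this.trans (mul_le_mul_of_nonneg_left h2 hL)
  have h4 : inner ℝ (gradVartheta M.θ (M.F z).abs - gradVartheta M.θ (M.linF a z).abs)
      ((M.linF a z).abs - (M.F z).abs) ≤ L * B * B * ‖a - z‖ ^ 2 := by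
    calc _ ≤ _ := real_inner_le_norm _ _
      _ ≤ (L * (B * ‖a - z‖)) * (B * ‖a - z‖) :=
        mul_le_mul h3 ((FMat.norm_abs_sub_abs_le _ _).trans h2) (norm_nonneg _) (by positivity)
      _ = _ := by ring
  have h5 := hQc (a - z)
  have h6 : 0 ≤ γ / 2 * ‖a - z‖ ^ 2 := by positivity
  simp only [inner_sub_left, inner_sub_right] at h1 h4 h5 h6 ⊢
  simp only [potentialReal, surrogateReal, surrogateConst, Triple.mk_fst, Triple.mk_snd_fst,
    Triple.mk_snd_snd]
  simp only [inner_sub_left] at h1 h4 h5 h6 ⊢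
  linarith

lemma BasicAssumption.exists_le_objReal (hM : M.BasicAssumption) (hν : 0 ≤ M.ν)
    (hlam : 0 < M.lam) : ∃ c : ℝ, ∀ x ∈ effDom M.h, c ≤ M.objReal x := by
  obtain ⟨cψ, hψ⟩ := hM.exists_le_ψ
  obtain ⟨ch, hch⟩ := hM.exists_le_hReal
  refine ⟨M.ν * cψ + M.lam * ch, fun x hx => ?_⟩
  have h1 := hM.θ_mem.vartheta_nonneg (M.F x)
  have h2 := mul_le_mul_of_nonneg_left (hψ (M.T x)) hν
  have h3 := mul_le_mul_of_nonneg_left (hch x hx) hlam.le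
  simp only [objReal]
  linarith

lemma BasicAssumption.continuousOn_objReal (hM : M.BasicAssumption) :
    ContinuousOn M.objReal (effDom M.h) := by
  have h1 := (hM.F_contDiff.continuousOn).mono hM.dom_subset
  have h2 := (hM.T_contDiff.continuousOn).mono hM.dom_subset
  exact ((hM.θ_mem.continuous_vartheta.comp_continuousOn h1).add
    (continuousOn_const.mul (hM.continuous_ψ.comp_continuousOn h2))).add
    (continuousOn_const.mul hM.continuousOn_hReal)

lemma BasicAssumption.continuousAt_surrogateReal [FiniteDimensional ℝ X] (hM : M.BasicAssumption)
    {z : X} (hz : z ∈ M.O) (Q : X →ₗ[ℝ] X) (y : X) :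
    ContinuousAt (fun z => M.surrogateReal z Q y) z := by
  have hn := hM.O_open.mem_nhds hz
  have f0 : ContinuousAt M.F z := hM.F_contDiff.continuousOn.continuousAt hn
  have t0 : ContinuousAt M.T z := hM.T_contDiff.continuousOn.continuousAt hn
  have f1 : ContinuousAt (fderiv ℝ M.F) z :=
    (hM.F_contDiff.continuousOn_fderiv_of_isOpen hM.O_open (by norm_num)).continuousAt hn
  have t1 : ContinuousAt (fderiv ℝ M.T) z :=
    (hM.T_contDiff.continuousOn_fderiv_of_isOpen hM.O_open (by norm_num)).continuousAt hn
  have hs : ContinuousAt (fun z : X => y - z) z := by fun_prop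
  have fl : ContinuousAt (fun z => M.linF y z) z := f0.add (f1.clm_apply hs)
  have tl : ContinuousAt (fun z => M.linT y z) z := t0.add (t1.clm_apply hs)
  have fa : ContinuousAt (fun z => (M.linF y z).abs) z := FMat.continuous_abs.continuousAt.comp fl
  have fa0 : ContinuousAt (fun z => (M.F z).abs) z := FMat.continuous_abs.continuousAt.comp f0
  have tψ : ContinuousAt (fun z => M.ψ (M.linT y z)) z := hM.continuous_ψ.continuousAt.comp tl
  have g : ContinuousAt (fun z => gradVartheta M.θ (M.F z).abs) z :=
    hM.θ_mem.continuous_gradVartheta.continuousAt.comp f0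
  have v : ContinuousAt (fun z => vartheta M.θ (M.F z).abs) z :=
    hM.θ_mem.continuous_vartheta.continuousAt.comp f0
  have hQ : ContinuousAt (fun z => Q (y - z)) z :=
    Q.continuous_of_finiteDimensional.continuousAt.comp hs
  exact ((((g.inner fa).add (continuousAt_const.mul tψ)).add
    (continuousAt_const.mul (hs.inner hQ))).add (v.sub (g.inner fa0))).add continuousAt_const

/-- A point of `dom h` that minimizes its own surrogate is stationary. -/
theorem BasicAssumption.isStationary_of_isMin [FiniteDimensional ℝ X] (hM : M.BasicAssumption)
    (hν : 0 ≤ M.ν) (hlam : 0 < M.lam) {x : X} {Q : X →ₗ[ℝ] X} (hQs : Q.IsSymmetric)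
    (hQ : ∀ u, 0 ≤ inner ℝ u (Q u)) (hx : x ∈ effDom M.h)
    (hmin : ∀ y ∈ effDom M.h, M.surrogateReal x Q x ≤ M.surrogateReal x Q y) :
    M.IsStationary x := by
  obtain ⟨s, u, η, hs, hu, hη, h0⟩ := hM.exists_multipliers hν hlam hQs hQ hx hmin
  rw [linF_self] at hs
  rw [linT_self] at hu
  refine ⟨hx, ?_⟩
  have hη' : η ∈ basicSubdiff M.h x := by
    refine mem_basicSubdiff_of_forall_le (hM.h_ne_bot x) (ne_of_lt hx) fun y => ?_
    by_cases hy : y ∈ effDom M.h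
    · rw [← hM.coe_hReal hx, ← hM.coe_hReal hy]
      exact_mod_cast hη y hy
    · rw [h_eq_top hy]; exact le_top
  refine ⟨_, ⟨_, ⟨FMat.hadamard (gradVartheta M.θ (M.F x).abs) s, fun ij =>
    ⟨s ij, (hs ij).mem_basicSubdiff, rfl⟩, rfl⟩, _, ⟨_, ⟨u, hu.mem_basicSubdiff, rfl⟩, rfl⟩, rfl⟩,
    _, ⟨η, hη', rfl⟩, ?_⟩
  refine ext_inner_right ℝ fun d => ?_
  have h1 := h0 d
  rw [sub_self, map_zero, inner_zero_left, add_zero] at h1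
  simp only [inner_add_left, real_inner_smul_left, LinearMap.adjoint_inner_left, inner_zero_left,
    ContinuousLinearMap.coe_coe]
  exact h1

/-! ### The KL inequality -/

/-- Here `φ' s = c * (1 - e) * s ^ (-e)`, and the norm of any subgradient bounds the distance from
`0` to the subdifferential from above. -/
lemma _root_.HasKLPropertyOfExponentAt.exists_rpow_le {E : Type*} [NormedAddCommGroup E]
    [InnerProductSpace ℝ E] {f : E → EReal} {e : ℝ} (he : e < 1) {a : E} {fa : ℝ}
    (hfa : f a = fa) (h : HasKLPropertyOfExponentAt f e a) :
    ∃ C : ℝ, 0 < C ∧ ∃ η : ℝ, 0 < η ∧ ∀ᶠ x in 𝓝 a, ∀ fx : ℝ, f x = fx → fa < fx → fx < fa + η →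
      ∀ v ∈ basicSubdiff f x, (fx - fa) ^ e ≤ C * ‖v‖ := by
  obtain ⟨η, c, hc, hη, -, V, hV, hKL⟩ := h
  obtain ⟨η', h0, h1⟩ := EReal.lt_iff_exists_real_btwn.1 hη
  have he' : 0 < 1 - e := by linarith
  refine ⟨c * (1 - e), by positivity, η', by exact_mod_cast h0, ?_⟩
  filter_upwards [hV] with x hx fx hfx hlt hlt' v hv
  have hs : 0 < fx - fa := by linarith
  have hk := hKL x hx (by rw [hfa, hfx]; exact_mod_cast hlt) (by
    rw [hfa, hfx]
    calc (fx : EReal) < ((fa + η' : ℝ) : EReal) := by exact_mod_cast hlt'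
      _ ≤ fa + η := by rw [EReal.coe_add]; gcongr)
  have hd : deriv (fun t : ℝ => c * t ^ (1 - e)) (fx - fa) = c * ((1 - e) * (fx - fa) ^ (-e)) := by
    have := ((Real.hasDerivAt_rpow_const (x := fx - fa) (p := 1 - e) (Or.inl hs.ne')).const_mul c)
    rw [this.deriv, show (1 - e - 1 : ℝ) = -e by ring]
  have ht : (f x - f a).toReal = fx - fa := by rw [hfa, hfx, ← EReal.coe_sub, EReal.toReal_coe]
  rw [ht, hd] at hk
  have hinf : Metric.infEDist 0 (basicSubdiff f x) ≤ ENNReal.ofReal ‖v‖ := by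
    refine (Metric.infEDist_le_edist_of_mem hv).trans ?_
    rw [edist_dist, dist_zero_left]
  have hp : 0 < (fx - fa) ^ e := by positivity
  have h2 : (1 : ENNReal) ≤ ENNReal.ofReal (c * ((1 - e) * (fx - fa) ^ (-e)) * ‖v‖) := by
    rw [ENNReal.ofReal_mul (by positivity)]
    exact hk.trans (by gcongr)
  rw [ENNReal.one_le_ofReal, Real.rpow_neg hs.le] at h2
  calc (fx - fa) ^ e = (fx - fa) ^ e * 1 := (mul_one _).symm
    _ ≤ (fx - fa) ^ e * (c * ((1 - e) * ((fx - fa) ^ e)⁻¹) * ‖v‖) := by gcongr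
    _ = _ := by field_simp

end CompositeModel

/-! ### From the KL property to a recursion, and stationarity of the limit. -/

namespace CompositeModel

variable {X : Type*} [NormedAddCommGroup X] [InnerProductSpace ℝ X] {m n p q : ℕ}
  {M : CompositeModel X m n p q} [FiniteDimensional ℝ X]

namespace IPMMRun

variable {R : M.IPMMRun}

/-- Triples near the iterates whose potential value lies above the next objective value and at
which the potential has a small subgradient. -/
theorem exists_test_triples (hM : M.BasicAssumption) (hν : 0 ≤ M.ν)
    (hlam : 0 < M.lam) (hF : ContDiffOn ℝ 2 M.F M.O) (hT : ContDiffOn ℝ 2 M.T M.O)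
    {K : Set X} (hK : IsCompact K) (hKc : Convex ℝ K) (hKD : K ⊆ effDom M.h)
    (hmem : ∀ k, R.x (k + 1) ∈ K ∧
      ∀ j ≤ R.last (k + 1), R.trial (k + 1) j ∈ K ∧ R.opt (k + 1) j ∈ K)
    {γt : ℝ} (hγt : ∀ k, R.γ k (R.last k) ≤ γt) {γ : ℝ} (hγ : 0 ≤ γ) :
    ∃ C : ℝ, 0 < C ∧ ∀ k, ∃ a ∈ K, ∃ t : ℝ,
      ∃ v ∈ regularSubdiff (M.potential γ) (Triple.mk a (R.x (k + 1)) t),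
      ‖v‖ ≤ C * √(M.objReal (R.x (k + 1)) - M.objReal (R.x (k + 2))) ∧
      ‖a - R.x (k + 1)‖ ≤ C * √(M.objReal (R.x (k + 1)) - M.objReal (R.x (k + 2))) ∧
      |t| ≤ C * √(M.objReal (R.x (k + 1)) - M.objReal (R.x (k + 2))) ∧
      M.objReal (R.x (k + 2)) ≤ M.potentialReal γ (Triple.mk a (R.x (k + 1)) t) ∧
      M.potentialReal γ (Triple.mk a (R.x (k + 1)) t) ≤ M.objReal (R.x (k + 1))
        + C * (M.objReal (R.x (k + 1)) - M.objReal (R.x (k + 2))) := by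
  have hϱ : 0 < R.ϱ := by linarith [R.one_lt_ϱ]
  have hγt0 : 0 < γt := R.γlo_pos.trans_le ((R.γlo_le 0 _ le_rfl).trans (hγt 0))
  have hc0 : 0 ≤ R.ϱ * γt := by positivity
  obtain ⟨C1, hC1, hdesc⟩ := exists_descent (R := R) hM hν hlam
  obtain ⟨C2, hC2, hpot⟩ := hM.exists_surrogateReal_le_potentialReal hF hγ hK hKc hKD hc0
  obtain ⟨C3, hC3, hsub⟩ := hM.exists_subgradient_potential hν hlam hF hT hγ hK hKc hKD hc0
  -- With `t ^ 2 = A * δ`, the summand `C1` pays for the gap between the next objective value and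
  -- the minimal surrogate value, and `C2 * C1 ^ 2` for the gap between surrogate and potential.
  set A := C1 + C2 * C1 ^ 2 with hA
  have hA0 : 0 ≤ A := by positivity
  have hsA : 0 ≤ √A := Real.sqrt_nonneg _
  have hγC : 0 ≤ γ / 2 * C1 ^ 2 := by positivity
  refine ⟨C1 + C3 * C1 + 2 * √A + (γ / 2 * C1 ^ 2 + A), by positivity, fun k => ?_⟩
  obtain ⟨d1, -, d3, d4⟩ := hdesc k
  have hδ : 0 ≤ M.objReal (R.x (k + 1)) - M.objReal (R.x (k + 2)) :=
    sub_nonneg.2 (objReal_lt hM hlam k).le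
  set δ := M.objReal (R.x (k + 1)) - M.objReal (R.x (k + 2))
  set a := R.opt (k + 1) (R.last (k + 1))
  have ha : a ∈ K := ((hmem k).2 _ le_rfl).2
  have hx := (hmem k).1
  have hQ := fun u => R.inner_Q_nonneg (k := k + 1) le_rfl u
  have hQc : ∀ u, inner ℝ u (R.Q (k + 1) (R.last (k + 1)) u) ≤ R.ϱ * γt * ‖u‖ ^ 2 := fun u =>
    (R.Q_upper (k + 1) _ le_rfl u).trans (by gcongr; exact hγt _)
  obtain ⟨v, hv, hvn⟩ := hsub a ha _ hx _ (R.Q_symm (k + 1) _ le_rfl) hQ hQc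
    (fun y hy => surrogateReal_opt_le hM hlam le_rfl hy) √(A * δ)
  have htt : √(A * δ) = √A * √δ := Real.sqrt_mul hA0 _
  have hsq : √(A * δ) ^ 2 = A * δ := Real.sq_sqrt (by positivity)
  have hs : 0 ≤ √δ := Real.sqrt_nonneg _
  have habs : |√(A * δ)| = √A * √δ := by rw [abs_of_nonneg (Real.sqrt_nonneg _), htt]
  have hd2 : ‖a - R.x (k + 1)‖ ^ 2 ≤ C1 ^ 2 * δ := by
    calc _ ≤ (C1 * √δ) ^ 2 := by gcongr
      _ = _ := by rw [mul_pow, Real.sq_sqrt hδ]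
  have p1 : 0 ≤ C1 * √δ := by positivity
  have p2 : 0 ≤ C3 * C1 * √δ := by positivity
  have p3 : 0 ≤ √A * √δ := by positivity
  have p4 : 0 ≤ (γ / 2 * C1 ^ 2 + A) * √δ := by positivity
  refine ⟨a, ha, √(A * δ), v, hv, ?_, ?_, ?_, ?_, ?_⟩
  · rw [habs] at hvn
    have := mul_le_mul_of_nonneg_left d1 hC3
    linarith
  · linarith
  · rw [habs]; linarith
  · have h1 := hpot a ha _ hx _ hQc √(A * δ)
    have h2 := mul_le_mul_of_nonneg_left hd2 hC2
    rw [hsq, hA] at h1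
    linarith
  · have h1 := hM.potentialReal_le (γ := γ) hQ a (R.x (k + 1)) √(A * δ)
    have h2 := mul_le_mul_of_nonneg_left hd2 (by positivity : 0 ≤ γ / 2)
    rw [hsq] at h1
    have q1 : 0 ≤ (C1 + C3 * C1 + 2 * √A) * δ := by positivity
    linarith

/-- The KL property of the potential turns into a recursive inequality for the objective values. -/
theorem exists_recursion (hM : M.BasicAssumption) (hν : 0 ≤ M.ν)
    (hlam : 0 < M.lam) (hF : ContDiffOn ℝ 2 M.F M.O) (hT : ContDiffOn ℝ 2 M.T M.O)
    {K : Set X} (hK : IsCompact K) (hKc : Convex ℝ K) (hKD : K ⊆ effDom M.h)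
    (hmem : ∀ k, R.x (k + 1) ∈ K ∧
      ∀ j ≤ R.last (k + 1), R.trial (k + 1) j ∈ K ∧ R.opt (k + 1) j ∈ K)
    {γt : ℝ} (hγt : ∀ k, R.γ k (R.last k) ≤ γt) {γ : ℝ} (hγ : 0 ≤ γ) {e : ℝ} (he0 : 0 < e)
    (he1 : e < 1) (hKL : IsKLFunctionOfExponentOn M.potentialDomain (M.potential γ) e) {l : ℝ}
    (hl : Tendsto (fun k => M.objReal (R.x (k + 1))) atTop (𝓝 l))
    (hlt : ∀ k, l < M.objReal (R.x (k + 1))) :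
    ∃ C : ℝ, 0 < C ∧ ∃ N : ℕ, ∀ k ≥ N, (M.objReal (R.x (k + 2)) - l) ^ e
      ≤ C * √(M.objReal (R.x (k + 1)) - M.objReal (R.x (k + 2))) := by
  obtain ⟨C0, hC0, htest⟩ := exists_test_triples (R := R) hM hν hlam hF hT hK hKc hKD hmem hγt hγ
  choose a ha t v hv hvn han htn hlow hup using htest
  have hδlim : Tendsto (fun k => M.objReal (R.x (k + 1)) - M.objReal (R.x (k + 2))) atTop
      (𝓝 0) := by
    have := hl.sub ((tendsto_add_atTop_iff_nat 1).2 hl)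
    simpa using this
  have hslim : Tendsto (fun k => C0 * √(M.objReal (R.x (k + 1)) - M.objReal (R.x (k + 2)))) atTop
      (𝓝 0) := by
    have := (hδlim.sqrt).const_mul C0
    simpa using this
  have hvlim : Tendsto v atTop (𝓝 0) := squeeze_zero_norm hvn hslim
  have htlim : Tendsto t atTop (𝓝 0) := squeeze_zero_norm htn hslim
  have halim : Tendsto (fun k => a k - R.x (k + 1)) atTop (𝓝 0) := squeeze_zero_norm han hslim
  have hΞlim : Tendsto (fun k => M.potentialReal γ (Triple.mk (a k) (R.x (k + 1)) (t k))) atTop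
      (𝓝 l) := by
    refine tendsto_of_tendsto_of_tendsto_of_le_of_le ((tendsto_add_atTop_iff_nat 1).2 hl)
      (?_ : Tendsto _ atTop (𝓝 l)) hlow hup
    simpa using hl.add (hδlim.const_mul C0)
  have along : ∀ (σ : ℕ → ℕ) (x : X), Tendsto σ atTop atTop → x ∈ K →
      Tendsto (fun i => R.x (σ i + 1)) atTop (𝓝 x) → ∃ C : ℝ, 0 < C ∧ ∀ᶠ i in atTop,
        (M.objReal (R.x (σ i + 2)) - l) ^ e
          ≤ C * √(M.objReal (R.x (σ i + 1)) - M.objReal (R.x (σ i + 2))) := by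
    intro σ x hσ hx hlim
    have hxl : M.objReal x = l := by
      have h1 := (hM.continuousOn_objReal x (hKD hx)).tendsto.comp
        (tendsto_nhdsWithin_iff.2 ⟨hlim, Eventually.of_forall fun i => hKD (hmem (σ i)).1⟩)
      exact tendsto_nhds_unique h1 (hl.comp hσ)
    have hw : Tendsto (fun i => Triple.mk (a (σ i)) (R.x (σ i + 1)) (t (σ i))) atTop
        (𝓝 (Triple.mk x x 0)) := by
      have h1 : Tendsto (fun i => a (σ i)) atTop (𝓝 x) := by
        have := (halim.comp hσ).add hlim
        simpa using this
      exact (Triple.continuous_mk.tendsto (x, x, 0)).comp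
        (h1.prodMk_nhds (hlim.prodMk_nhds (htlim.comp hσ)))
    have hval : M.potential γ (Triple.mk x x 0) = (l : EReal) := by
      rw [← hM.coe_potentialReal (w := Triple.mk x x 0) (hKD hx), potentialReal_diag, hxl]
    have hvalk : ∀ k, M.potential γ (Triple.mk (a k) (R.x (k + 1)) (t k))
        = (M.potentialReal γ (Triple.mk (a k) (R.x (k + 1)) (t k)) : EReal) := fun k =>
      (hM.coe_potentialReal (w := Triple.mk (a k) (R.x (k + 1)) (t k)) (hKD (ha k)) γ).symm
    -- The test subgradients tend to `0` and the potential values converge, so `0` is a limiting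
    -- subgradient and the KL property is available at this point.
    have hne : (basicSubdiff (M.potential γ) (Triple.mk x x 0)).Nonempty := by
      refine ⟨0, by rw [hval]; exact EReal.coe_ne_bot _, by rw [hval]; exact EReal.coe_ne_top _,
        _, fun i => v (σ i), hw, ?_, fun i => hv (σ i), hvlim.comp hσ⟩
      rw [hval]
      simp only [hvalk]
      exact (continuous_coe_real_ereal.tendsto l).comp (hΞlim.comp hσ)
    obtain ⟨C, hC, η, hη, hev⟩ := (hKL.kl (Triple.mk x x 0) (hM.dom_subset (hKD hx))
      hne).exists_rpow_le he1 hval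
    refine ⟨C * C0, by positivity, ?_⟩
    filter_upwards [hw.eventually hev, (hΞlim.comp hσ).eventually (gt_mem_nhds
      (lt_add_of_pos_right l hη))] with i hi hi'
    have hlo := hlow (σ i)
    have hl2 := hlt (σ i + 1)
    have h1 := hi _ (hvalk _) (hl2.trans_le hlo) hi' _
      (mem_basicSubdiff_of_mem_regularSubdiff (hv (σ i)))
    calc (M.objReal (R.x (σ i + 2)) - l) ^ e
        ≤ (M.potentialReal γ (Triple.mk (a (σ i)) (R.x (σ i + 1)) (t (σ i))) - l) ^ e :=
          Real.rpow_le_rpow (sub_nonneg.2 hl2.le) (by linarith) he0.le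
      _ ≤ C * ‖v (σ i)‖ := h1
      _ ≤ C * (C0 * √(M.objReal (R.x (σ i + 1)) - M.objReal (R.x (σ i + 2)))) := by
          gcongr
          exact hvn _
      _ = _ := by ring
  -- The constant in `along` depends on the cluster point. If no uniform one existed, indices
  -- violating the bound with constant `i + 1` would have a convergent subsequence, contradicting
  -- `along`.
  by_contra hcon
  push Not at hcon
  choose κ hκ hκ' using fun i : ℕ => hcon ((i : ℝ) + 1) (by positivity) i
  obtain ⟨x, hx, φ, hφ, hlim⟩ := hK.tendsto_subseq (fun i => (hmem (κ i)).1)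
  have hκt : Tendsto (fun i => κ (φ i)) atTop atTop :=
    tendsto_atTop_mono (fun i => (hφ.id_le i).trans (hκ (φ i))) tendsto_id
  obtain ⟨C, hC, hev⟩ := along (fun i => κ (φ i)) x hκt hx hlim
  obtain ⟨i, hi, hi'⟩ := (hev.and (eventually_ge_atTop ⌈C⌉₊)).exists
  have h1 := hκ' (φ i)
  have h2 : C ≤ (φ i : ℝ) + 1 := by
    have h3 : (⌈C⌉₊ : ℝ) ≤ φ i := by exact_mod_cast hi'.trans (hφ.id_le i)
    linarith [Nat.le_ceil C]
  have h3 := mul_le_mul_of_nonneg_right h2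
    (Real.sqrt_nonneg (M.objReal (R.x (κ (φ i) + 1)) - M.objReal (R.x (κ (φ i) + 2))))
  linarith

/-- The limit of the iterates is stationary. -/
theorem isStationary_of_tendsto (hM : M.BasicAssumption) (hν : 0 ≤ M.ν) (hlam : 0 < M.lam)
    {γt : ℝ} (hγt : ∀ k, R.γ k (R.last k) ≤ γt) {x : X} (hx : x ∈ effDom M.h)
    (hlim : Tendsto (fun k => R.x (k + 1)) atTop (𝓝 x)) : M.IsStationary x := by
  have hϱ : 0 < R.ϱ := by linarith [R.one_lt_ϱ]
  have hγt0 : 0 < γt := R.γlo_pos.trans_le ((R.γlo_le 0 _ le_rfl).trans (hγt 0))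
  obtain ⟨C, hC, hdesc⟩ := exists_descent (R := R) hM hν hlam
  set c := R.ϱ * γt with hc
  have hc0 : 0 ≤ c := by positivity
  -- This operator dominates all accepted `Q k j`. The minimality of the subproblem solutions
  -- therefore passes to the limit although the operators themselves need not converge.
  set Q : X →ₗ[ℝ] X := c • LinearMap.id with hQ
  have hQi : ∀ u : X, inner ℝ u (Q u) = c * ‖u‖ ^ 2 := fun u => by
    simp [hQ, real_inner_smul_right]
  have hol : Tendsto (fun k => M.objReal (R.x (k + 1))) atTop (𝓝 (M.objReal x)) :=
    (hM.continuousOn_objReal x hx).tendsto.comp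
      (tendsto_nhdsWithin_iff.2 ⟨hlim, Eventually.of_forall fun k => R.x_succ_mem hlam k⟩)
  have hol' := (tendsto_add_atTop_iff_nat 1).2 hol
  refine hM.isStationary_of_isMin hν hlam (Q := Q) (fun u w => ?_) (fun u => ?_) hx
    (fun y hy => ?_)
  · simp [hQ, real_inner_smul_left, real_inner_smul_right]
  · rw [hQi]; positivity
  rw [surrogateReal_self]
  have h1 : Tendsto (fun k => M.objReal (R.x (k + 1 + 1))
      - C * (M.objReal (R.x (k + 1)) - M.objReal (R.x (k + 1 + 1)))) atTop
      (𝓝 (M.objReal x)) := by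
    have := hol'.sub ((hol.sub hol').const_mul C)
    simpa using this
  have h2 := (hM.continuousAt_surrogateReal (hM.dom_subset hx) Q y).tendsto.comp hlim
  refine le_of_tendsto_of_tendsto' h1 h2 fun k => ?_
  have h3 := (hdesc k).2.2.1
  have h4 := surrogateReal_opt_le (R := R) hM hlam (k := k + 1) le_rfl hy
  have h5 : M.surrogateReal (R.x (k + 1)) (R.Q (k + 1) (R.last (k + 1))) y
      ≤ M.surrogateReal (R.x (k + 1)) Q y := by
    have h6 := R.Q_upper (k + 1) _ le_rfl (y - R.x (k + 1))
    have h7 : R.ϱ * R.γ (k + 1) (R.last (k + 1)) * ‖y - R.x (k + 1)‖ ^ 2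
        ≤ c * ‖y - R.x (k + 1)‖ ^ 2 := by
      rw [hc]
      gcongr
      exact hγt _
    simp only [surrogateReal, hQi]
    linarith
  change M.objReal (R.x (k + 2)) - C * (_ - M.objReal (R.x (k + 2))) ≤
    M.surrogateReal (R.x (k + 1)) Q y
  linarith

end IPMMRun

end CompositeModel

/-! ### Convergence of the iterates and the rates. -/

open CompositeModel CompositeModel.IPMMRun in
theorem mainTheorem2 {X : Type*} [NormedAddCommGroup X] [InnerProductSpace ℝ X]
    [FiniteDimensional ℝ X] {m n p q : ℕ} (M : CompositeModel X m n p q)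
    (hM : M.BasicAssumption) (hν : 0 ≤ M.ν) (hlam : 0 < M.lam) (R : M.IPMMRun)
    (hbdd : Bornology.IsBounded (Set.range R.x))
    (hF : ContDiffOn ℝ 2 M.F M.O) (hT : ContDiffOn ℝ 2 M.T M.O) :
    (∃ γt : ℝ, 0 < γt ∧ ∀ k, R.γ k (R.last k) ≤ γt) ∧
    ∀ γt : ℝ, 0 < γt → (∀ k, R.γ k (R.last k) ≤ γt) →
    ∀ e : ℝ, e ∈ Set.Ioo (0 : ℝ) 1 →
    IsKLFunctionOfExponentOn M.potentialDomain (M.potential (2 * R.ϱ * γt)) e →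
    ∃ xstar : X, M.IsStationary xstar ∧ Tendsto R.x atTop (𝓝 xstar) ∧
      (e ≤ 1 / 2 → ∃ C : ℝ, 0 < C ∧ ∃ r : ℝ, r ∈ Set.Ioo (0 : ℝ) 1 ∧
        ∀ᶠ k : ℕ in atTop, M.obj (R.x k) - M.obj xstar ≤ ((C * r ^ k : ℝ) : EReal)) ∧
      (1 / 2 < e → ∃ C : ℝ, 0 < C ∧
        ∀ᶠ k : ℕ in atTop, M.obj (R.x k) - M.obj xstar
          ≤ ((C * (k : ℝ) ^ (-(1 / (2 * e - 1))) : ℝ) : EReal)) := by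
  refine ⟨exists_γ_le hM hν hlam hbdd hF hT, fun γt hγt0 hγt e he hKL => ?_⟩
  have : CompleteSpace X := FiniteDimensional.complete ℝ X
  have hϱ : 0 < R.ϱ := by linarith [R.one_lt_ϱ]
  obtain ⟨K, hK, hKc, hKD, hmem⟩ := exists_compact hM hν hlam hbdd
  have hanti : StrictAnti fun k => M.objReal (R.x (k + 1)) :=
    strictAnti_nat_of_succ_lt fun k => objReal_lt hM hlam k
  obtain ⟨c, hc⟩ := hM.exists_le_objReal hν hlam
  have hbelow : BddBelow (range fun k => M.objReal (R.x (k + 1))) :=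
    ⟨c, by rintro _ ⟨k, rfl⟩; exact hc _ (R.x_succ_mem hlam k)⟩
  have hl := tendsto_atTop_ciInf hanti.antitone hbelow
  set l := ⨅ k, M.objReal (R.x (k + 1))
  -- The first inexactness condition is strict, so the limit value is never attained and negative
  -- powers of the gaps make sense.
  have hlt : ∀ k, l < M.objReal (R.x (k + 1)) := fun k =>
    (ciInf_le hbelow (k + 1)).trans_lt (hanti (Nat.lt_succ_self k))
  obtain ⟨C, hC, N, hrec⟩ := exists_recursion hM hν hlam hF hT hK hKc hKD hmem hγt
    (by positivity : 0 ≤ 2 * R.ϱ * γt) he.1 he.2 hKL hl hlt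
  set r : ℕ → ℝ := fun k => M.objReal (R.x k) - l with hr
  have hsub : ∀ k, r k - r (k + 1) = M.objReal (R.x k) - M.objReal (R.x (k + 1)) := fun k => by
    simp [hr]
  -- The shift by one discards `r 0`, since `objReal` need not represent `Θ` at the starting point.
  have hpos : ∀ k ≥ N + 1, 0 < r k := fun k hk => by
    obtain ⟨i, rfl⟩ := Nat.exists_eq_add_of_le' (Nat.le_of_add_left_le hk)
    exact sub_pos.2 (hlt i)
  have hdec : ∀ k ≥ N + 1, r (k + 1) ≤ r k := fun k hk => by
    obtain ⟨i, rfl⟩ := Nat.exists_eq_add_of_le' (Nat.le_of_add_left_le hk)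
    exact sub_le_sub_right (hanti (Nat.lt_succ_self i)).le l
  have hrec' : ∀ k ≥ N + 1, r (k + 1) ^ e ≤ C * √(r k - r (k + 1)) := fun k hk => by
    obtain ⟨i, rfl⟩ := Nat.exists_eq_add_of_le' (Nat.le_of_add_left_le hk)
    rw [hsub]
    exact hrec i (by omega)
  have hr0 : Tendsto r atTop (𝓝 0) := by
    rw [← tendsto_add_atTop_iff_nat 1, ← sub_self l]
    exact hl.sub_const l
  have hsum := summable_sqrt_sub_of_rpow_le he.1 he.2 hC hpos hdec hrec'
  obtain ⟨C1, hC1, hdesc⟩ := exists_descent (R := R) hM hν hlam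
  -- Step lengths are at most `C1 * √(r k - r (k + 1))`, which is summable, so the path has finite
  -- length.
  have hcauchy : CauchySeq fun k => R.x (k + 1) := by
    refine cauchySeq_of_summable_dist (Summable.of_nonneg_of_le (fun _ => dist_nonneg)
      (fun k => ?_) (((summable_nat_add_iff 1).2 hsum).mul_left C1))
    rw [dist_comm, dist_eq_norm, hsub]
    exact (hdesc k).2.1
  obtain ⟨x, hx⟩ := cauchySeq_tendsto_of_complete hcauchy
  have hxK : x ∈ K := hK.isClosed.mem_of_tendsto hx (Eventually.of_forall fun k => (hmem k).1)
  have hxl : M.objReal x = l := tendsto_nhds_unique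
    ((hM.continuousOn_objReal x (hKD hxK)).tendsto.comp
      (tendsto_nhdsWithin_iff.2 ⟨hx, Eventually.of_forall fun k => R.x_succ_mem hlam k⟩)) hl
  have hobj : ∀ k ≥ 1, M.obj (R.x k) - M.obj x = (r k : EReal) := fun k hk => by
    obtain ⟨i, rfl⟩ := Nat.exists_eq_add_of_le' hk
    rw [← hM.coe_objReal (R.x_succ_mem hlam i), ← hM.coe_objReal (hKD hxK), hxl, ← EReal.coe_sub]
  refine ⟨x, isStationary_of_tendsto hM hν hlam hγt (hKD hxK) hx,
    (tendsto_add_atTop_iff_nat 1).1 hx, fun he' => ?_, fun he' => ?_⟩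
  · obtain ⟨A, hA, ρ, hρ, hev⟩ := linear_rate_of_rpow_le he' hC hpos hdec hr0 hrec'
    refine ⟨A, hA, ρ, hρ, ?_⟩
    filter_upwards [hev, eventually_ge_atTop 1] with k hk hk1
    rw [hobj k hk1]
    exact_mod_cast hk
  · obtain ⟨A, hA, hev⟩ := sublinear_rate_of_rpow_le he' hC hpos hdec hrec'
    refine ⟨A, hA, ?_⟩
    filter_upwards [hev, eventually_ge_atTop 1] with k hk hk1
    rw [hobj k hk1]
    exact_mod_cast hk
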